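/- Let $K=\mathbb F_2$, let $p$ be an odd prime, let $s(p)$ be the multiplicative order of $2$ modulo $p$, and put $\nu=(p-1)/s(p)$. Let $C\subseteq K^n$ be a binary self-dual code and let $g\in\operatorname{Aut}(C)\le S_n$ be an automorphism of order $2p$ such that the involution $g^p$ has no fixed points on the $n$ coordinates. Let $x$ be the number of $2p$-cycles and $w$ the number of $2$-cycles of $g$. There are exactly $1+\nu$ irreducible $K\langle g\rangle$-modules up to isomorphism. Let $V_0,V_1,\dots,V_\nu$ be any numbering of them in which $V_0=K$ is the trivial module, and let $W_i$ be the projective cover of $V_i$. Then there are integers $y_i,z_i\ge 0$ $(0\le i\le \nu)$ such that, as a $K\langle g\rangle$-module, $$C\;\cong\;\bigoplus_{i=0}^{\nu}\bigl(W_i^{\,y_i}\oplus V_i^{\,z_i}\bigr),$$ and all integers $y_i,z_i\ge 0$ with this property satisfy: 1) $2y_0+z_0=x+w$; 2a) if $s(p)$ is even, then $2y_i+z_i=x$ for all $i\in\{1,\dots,\nu\}$; 2b) if $s(p)$ is odd, then for every $i\in\{1,\dots,\nu\}$ there is a (necessarily unique) index $i'\in\{1,\dots,\nu\}$ with $V_{i'}\cong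 V_i^{*}$ (the dual module), one has $i'\neq i$, and $z_i=z_{i'}$ and $y_i+y_{i'}+z_i=x$. -/

import Mathlib

open scoped MonoidAlgebra

noncomputable section

namespace BinaryCode

/-- A binary linear code of length `n`: a subspace of `F_2^n`. -/
abbrev Code (n : ℕ) : Type := Submodule (ZMod 2) (Fin n → ZMod 2)

/-- The dual code with respect to the standard bilinear form. -/
def dualCode {n : ℕ} (C : Code n) : Code n where
  carrier := {v | ∀ c ∈ C, v ⬝ᵥ c = 0}
  zero_mem' := fun c _ => zero_dotProduct c
  add_mem' := by
    intro a b ha hb c hc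
    rw [add_dotProduct, ha c hc, hb c hc, add_zero]
  smul_mem' := by
    intro r a ha c hc
    rw [smul_dotProduct, ha c hc, smul_zero]

/-- A code is self-dual if it equals its dual code. -/
def IsSelfDual {n : ℕ} (C : Code n) : Prop := C = dualCode C

/-- The action of the symmetric group on `F_2^n` by permutation of the coordinates:
the entry of `c` at position `i` is moved to position `σ i`. -/
def permRep (n : ℕ) : Representation (ZMod 2) (Equiv.Perm (Fin n)) (Fin n → ZMod 2) where
  toFun σ := LinearMap.funLeft (ZMod 2) (ZMod 2) (⇑(σ⁻¹))
  map_one' := rfl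
  map_mul' σ τ := by
    rw [mul_inv_rev]
    rfl

/-- The automorphism group of a code: the coordinate permutations that map the code to itself. -/
def autGroup {n : ℕ} (C : Code n) : Subgroup (Equiv.Perm (Fin n)) where
  carrier := {σ | C.map (permRep n σ) = C}
  one_mem' := by
    change C.map (permRep n 1) = C
    rw [map_one]
    exact Submodule.map_id C
  mul_mem' := by
    intro σ τ (hσ : C.map (permRep n σ) = C) (hτ : C.map (permRep n τ) = C)
    change C.map (permRep n (σ * τ)) = C
    have h := Submodule.map_comp (permRep n τ) (permRep n σ) C
    rw [hτ, hσ] at h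
    rw [map_mul]
    exact h
  inv_mem' := by
    intro σ (hσ : C.map (permRep n σ) = C)
    change C.map (permRep n σ⁻¹) = C
    have h := Submodule.map_comp (permRep n σ) (permRep n σ⁻¹) C
    rw [hσ] at h
    rw [← h]
    have h1 : permRep n σ⁻¹ ∘ₗ permRep n σ = LinearMap.id := by
      have := (map_mul (permRep n) σ⁻¹ σ).symm
      rw [inv_mul_cancel, map_one] at this
      exact this
    rw [h1, Submodule.map_id]

/-- For an automorphism `g` of the code `C`, the representation of the cyclic group `⟨g⟩` on `C`. -/
def codeRep {n : ℕ} (C : Code n) (g : Equiv.Perm (Fin n)) (hg : g ∈ autGroup C) :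
    Representation (ZMod 2) (Subgroup.zpowers g) C :=
  Representation.subrepresentation ((permRep n).comp (Subgroup.zpowers g).subtype) C (by
    rintro ⟨σ, hσ⟩
    have h : C.map (permRep n σ) = C := (Subgroup.zpowers_le.mpr hg) hσ
    exact Submodule.map_le_iff_le_comap.mp h.le)

/-- The number of cycles of length `k` (where `2 ≤ k`) of the permutation `g`. -/
def numCycles {n : ℕ} (g : Equiv.Perm (Fin n)) (k : ℕ) : ℕ := g.cycleType.count k

/-- `s(p)`, the multiplicative order of `2` modulo `p`. -/
def ordTwo (p : ℕ) : ℕ := orderOf (2 : ZMod p)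

/-- `ν = (p - 1) / s(p)`; for an odd prime `p` this division is exact. -/
def nu (p : ℕ) : ℕ := (p - 1) / ordTwo p

/-- `P` is a projective cover of the `R`-module `M`: it is projective and has a surjection to `M`
whose kernel is superfluous. -/
def IsProjectiveCover (R P M : Type*) [Ring R] [AddCommGroup P] [Module R P]
    [AddCommGroup M] [Module R M] : Prop :=
  Module.Projective R P ∧
    ∃ f : P →ₗ[R] M, Function.Surjective f ∧
      ∀ N : Submodule R P, N ⊔ LinearMap.ker f = ⊤ → N = ⊤

/-- `V_0, …, V_m` is a numbering of the isomorphism classes of irreducible `F_2 G`-modules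
(each class occurring exactly once), in which `V_0` is the trivial module. -/
structure IsNumberingOfIrreducibles (G : Type) [Group G] (m : ℕ)
    (V : Fin (m + 1) → Rep.{0} (ZMod 2) G) : Prop where
  irreducible : ∀ i, (V i).ρ.IsIrreducible
  injective : ∀ i j, Nonempty ((V i).ρ.Equiv (V j).ρ) → i = j
  complete : ∀ U : Rep.{0} (ZMod 2) G, U.ρ.IsIrreducible →
    ∃ i, Nonempty (U.ρ.Equiv (V i).ρ)
  trivial : Nonempty ((V 0).ρ.Equiv (Representation.trivial (ZMod 2) G (ZMod 2)))

/-- The representation `ρ` is, as an `F_2 G`-module, isomorphic to the direct sum over `i` of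
`y i` copies of `W i` and `z i` copies of `V i`. -/
def HasDecomposition {G : Type} [Group G] {M : Type} [AddCommGroup M] [Module (ZMod 2) M]
    (ρ : Representation (ZMod 2) G M) {m : ℕ} (V W : Fin (m + 1) → Rep.{0} (ZMod 2) G)
    (y z : Fin (m + 1) → ℕ) : Prop :=
  Nonempty (ρ.asModule ≃ₗ[(ZMod 2)[G]]
    ((i : Fin (m + 1)) → (Fin (y i) → (W i).ρ.asModule) × (Fin (z i) → (V i).ρ.asModule)))

end BinaryCode

end

open scoped MonoidAlgebra

noncomputable section

namespace BinaryCode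

/-! ### Factors of `X ^ p - 1` over `F_2` and their reciprocals. -/

section Polynomials

open Polynomial UniqueFactorizationMonoid

/-! Since `⟨g⟩` is cyclic of order `2p`, its group algebra over `F_2` is `F_2[X]/(X ^ p - 1) ^ 2`,
with `X ^ p - 1` squarefree. For `f` running over the irreducible factors of `X ^ p - 1`, the
irreducible modules are `F_2[X]/(f)`, with projective covers `F_2[X]/(f ^ 2)`. There is no other
indecomposable module, so the structure theorem over a principal ideal domain yields the
decomposition of `C`. Dualizing a module replaces `f` by its reciprocal `f*`. For `f ≠ X - 1`, of
degree `s(p)`, one has `f* = f` exactly when `s(p)` is even (`reverse_eq_self_of_even`,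
`reverse_ne_self_of_odd`).

The multiplicities come from a single inequality. Put `d = deg f`, with `f` belonging to `V_i` and
`f*` to `V_{i'}`. The adjoint of `f*(g)` is `f*(g⁻¹)`, which has the same kernel as `f(g)`. Hence `C
∩ ker f(g)` is orthogonal both to `C` and to the image of `f*(g)`, and a dimension count gives `dim
(C ∩ ker f(g)) + rank f*(g) ≤ dim C + dim (C ∩ im f*(g))` (`IsSelfDual.finrank_inf_ker_add_le`). The
first term is at least `d (y_i + z_i)`, the last is at most `dim C - d y_{i'}`, and the corank of
`f*(g)` is at most `d N_i`, where `N_0 = x + w` and `N_i = x` for `i ≠ 0`. So `y_i + y_{i'} + z_i ≤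
N_i`.

Weighted by the degrees and summed over `i`, the left sides give `dim C = n / 2` and the right sides
give `p x + w`, which is the same number because `g` has only cycles of length `2p` and `2`. Every
inequality is therefore an equality (`HasDecomposition.multiplicities`). Comparing the equalities
for `i` and `i'` gives `z_i = z_{i'}`. -/

lemma reverse_reverse_of_coeff_zero_ne {R : Type*} [Semiring R] {f : R[X]} (hf : f.coeff 0 ≠ 0) :
    f.reverse.reverse = f := by
  have h : f.reverse.natDegree = f.natDegree := by
    rw [reverse_natDegree, natTrailingDegree_eq_zero.2 (Or.inr hf), Nat.sub_zero]
  rw [reverse, h, reverse]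
  ext k
  rw [coeff_reflect, coeff_reflect, revAt_invol]

lemma natDegree_reverse_of_coeff_zero_ne {R : Type*} [Semiring R] {f : R[X]}
    (hf : f.coeff 0 ≠ 0) : f.reverse.natDegree = f.natDegree := by
  rw [reverse_natDegree, natTrailingDegree_eq_zero.2 (Or.inr hf), Nat.sub_zero]

lemma coeff_zero_ne_of_dvd_X_pow_sub_one {K : Type*} [Field K] {f : K[X]} {N : ℕ} (hN : N ≠ 0)
    (h : f ∣ X ^ N - 1) : f.coeff 0 ≠ 0 := by
  obtain ⟨u, hu⟩ := h
  intro h0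
  have := congrArg (fun q => q.coeff 0) hu
  simp [mul_coeff_zero, h0, coeff_X_pow, hN.symm] at this

lemma irreducible_reverse {K : Type*} [Field K] {f : K[X]} (hf : Irreducible f)
    (h0 : f.coeff 0 ≠ 0) : Irreducible f.reverse := by
  have hf0 : f ≠ 0 := hf.ne_zero
  refine ⟨fun hu => hf.not_isUnit ?_, fun a b hab => ?_⟩
  · rw [Polynomial.isUnit_iff_degree_eq_zero, degree_eq_natDegree hf0]
    rw [← natDegree_reverse_of_coeff_zero_ne h0, natDegree_eq_zero_of_isUnit hu, Nat.cast_zero]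
  · have key : f = a.reverse * b.reverse := by
      rw [← reverse_mul_of_domain, ← hab, reverse_reverse_of_coeff_zero_ne h0]
    have hr0 : f.reverse.coeff 0 ≠ 0 := by
      rw [coeff_zero_reverse]; exact leadingCoeff_ne_zero.2 hf0
    rw [hab, mul_coeff_zero] at hr0
    have ha := left_ne_zero_of_mul hr0
    have hb := right_ne_zero_of_mul hr0
    have haux : ∀ q : K[X], q.coeff 0 ≠ 0 → IsUnit q.reverse → IsUnit q := by
      intro q hq hu
      have hq0 : q ≠ 0 := by rintro rfl; simp at hq
      rw [Polynomial.isUnit_iff_degree_eq_zero, degree_eq_natDegree hq0,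
        ← natDegree_reverse_of_coeff_zero_ne hq, natDegree_eq_zero_of_isUnit hu, Nat.cast_zero]
    exact (hf.isUnit_or_isUnit key).imp (haux a ha) (haux b hb)

lemma monic_of_ne_zero_zmodTwo {f : (ZMod 2)[X]} (hf : f ≠ 0) : f.Monic := by
  have h := leadingCoeff_ne_zero.2 hf
  have : ∀ a : ZMod 2, a ≠ 0 → a = 1 := by decide
  exact this _ h

/-- The monic irreducible factors of `X ^ p - 1` over `F_2`. -/
def irredFactors (p : ℕ) : Finset (ZMod 2)[X] :=
  (normalizedFactors (X ^ p - 1 : (ZMod 2)[X])).toFinset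

variable {p : ℕ}

lemma X_pow_sub_one_ne_zero' (hp : p ≠ 0) : (X ^ p - 1 : (ZMod 2)[X]) ≠ 0 :=
  (monic_X_pow_sub_C (1 : ZMod 2) hp).ne_zero

lemma mem_irredFactors (hp : p ≠ 0) {f : (ZMod 2)[X]} :
    f ∈ irredFactors p ↔ Irreducible f ∧ f ∣ X ^ p - 1 := by
  rw [irredFactors, Multiset.mem_toFinset, Polynomial.mem_normalizedFactors_iff (X_pow_sub_one_ne_zero' hp)]
  exact ⟨fun h => ⟨h.1, h.2.2⟩, fun h => ⟨h.1, monic_of_ne_zero_zmodTwo h.1.ne_zero, h.2⟩⟩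

lemma reverse_X_pow_sub_one (p : ℕ) :
    (X ^ p - 1 : (ZMod 2)[X]).reverse = X ^ p - 1 := by
  have hd : (X ^ p - 1 : (ZMod 2)[X]).natDegree = p := natDegree_X_pow_sub_C (r := 1)
  rw [reverse, hd, reflect_sub, reflect_one, reflect_monomial, revAt_le le_rfl, Nat.sub_self,
    pow_zero, CharTwo.sub_eq_add, CharTwo.sub_eq_add, add_comm]

lemma reverse_mem_irredFactors (hp : p ≠ 0) {f : (ZMod 2)[X]} (hf : f ∈ irredFactors p) :
    f.reverse ∈ irredFactors p := by
  rw [mem_irredFactors hp] at hf ⊢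
  have h0 := coeff_zero_ne_of_dvd_X_pow_sub_one hp hf.2
  refine ⟨irreducible_reverse hf.1 h0, ?_⟩
  obtain ⟨u, hu⟩ := hf.2
  rw [← reverse_X_pow_sub_one p, hu, reverse_mul_of_domain]
  exact dvd_mul_right _ _

lemma reverse_reverse_of_mem (hp : p ≠ 0) {f : (ZMod 2)[X]} (hf : f ∈ irredFactors p) :
    f.reverse.reverse = f :=
  reverse_reverse_of_coeff_zero_ne
    (coeff_zero_ne_of_dvd_X_pow_sub_one hp ((mem_irredFactors hp).1 hf).2)

lemma natDegree_reverse_of_mem (hp : p ≠ 0) {f : (ZMod 2)[X]} (hf : f ∈ irredFactors p) :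
    f.reverse.natDegree = f.natDegree :=
  natDegree_reverse_of_coeff_zero_ne
    (coeff_zero_ne_of_dvd_X_pow_sub_one hp ((mem_irredFactors hp).1 hf).2)

lemma squarefree_X_pow_sub_one (hp : Odd p) : Squarefree (X ^ p - 1 : (ZMod 2)[X]) := by
  refine (X_pow_sub_one_separable_iff.2 ?_).squarefree
  rw [(ZMod.natCast_eq_one_iff_odd).2 hp]
  exact one_ne_zero

lemma prod_irredFactors (hp : Odd p) : ∏ f ∈ irredFactors p, f = X ^ p - 1 := by
  have h0 : (X ^ p - 1 : (ZMod 2)[X]) ≠ 0 := X_pow_sub_one_ne_zero' hp.pos.ne'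
  have hn := (squarefree_iff_nodup_normalizedFactors h0).1 (squarefree_X_pow_sub_one hp)
  have h1 := prod_normalizedFactors_eq h0
  have hm : (X ^ p - 1 : (ZMod 2)[X]).Monic := monic_X_pow_sub_C (1 : ZMod 2) hp.pos.ne'
  rw [hm.normalize_eq_self] at h1
  rw [irredFactors, Finset.prod_eq_multiset_prod, Multiset.toFinset_val, hn.dedup,
    Multiset.map_id', h1]

lemma sum_natDegree_irredFactors (hp : Odd p) : ∑ f ∈ irredFactors p, f.natDegree = p := by
  rw [← natDegree_prod, prod_irredFactors hp]
  · exact natDegree_X_pow_sub_C (r := 1)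
  · intro f hf
    exact ((mem_irredFactors hp.pos.ne').1 hf).1.ne_zero

lemma X_sub_one_mem_irredFactors (hp : p ≠ 0) : (X - 1 : (ZMod 2)[X]) ∈ irredFactors p := by
  rw [mem_irredFactors hp]
  exact ⟨irreducible_X_sub_C (1 : ZMod 2), sub_one_dvd_pow_sub_one X p⟩

lemma orderOf_unitOfCoprime_two (h : Nat.Coprime (2 ^ 1) p) :
    orderOf (ZMod.unitOfCoprime (2 ^ 1) h) = ordTwo p := by
  rw [ordTwo, ← orderOf_units, ZMod.coe_unitOfCoprime]
  norm_num

lemma natDegree_eq_ordTwo (hp : p.Prime) (hp2 : Odd p) {f : (ZMod 2)[X]} (hf : f ∈ irredFactors p)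
    (hf1 : f ≠ X - 1) : f.natDegree = ordTwo p := by
  have := Fact.mk hp
  obtain ⟨hi, hd⟩ := (mem_irredFactors hp.ne_zero).1 hf
  have hc : Nat.Coprime 2 p := Nat.coprime_two_left.2 hp2
  have hm := monic_of_ne_zero_zmodTwo hi.ne_zero
  rw [← cyclotomic_prime_mul_X_sub_one] at hd
  rcases hi.prime.dvd_or_dvd hd with h | h
  · rw [natDegree_of_dvd_cyclotomic_of_irreducible (p := 2) (f := 1) (by simp) hc h hi,
      orderOf_unitOfCoprime_two]
  · exact absurd (eq_of_monic_of_associated hm (monic_X_sub_C (1 : ZMod 2))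
      (hi.associated_of_dvd (irreducible_X_sub_C (1 : ZMod 2)) h)) hf1

/-- The degrees sum to `p`; `X - 1` contributes `1` and every other factor contributes `s(p)`. -/
lemma card_irredFactors (hp : p.Prime) (hp2 : Odd p) : (irredFactors p).card = nu p + 1 := by
  have hs := sum_natDegree_irredFactors hp2
  have h1 := X_sub_one_mem_irredFactors hp.ne_zero
  have hd1 : (X - 1 : (ZMod 2)[X]).natDegree = 1 := natDegree_X_sub_C (1 : ZMod 2)
  rw [← Finset.add_sum_erase _ _ h1, hd1, Finset.sum_congr rfl (g := fun _ => ordTwo p)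
    (fun f hf => natDegree_eq_ordTwo hp hp2 (Finset.mem_of_mem_erase hf)
      (Finset.ne_of_mem_erase hf)), Finset.sum_const, smul_eq_mul] at hs
  have hpos : 0 < ordTwo p := by
    have hc : Nat.Coprime (2 ^ 1) p := Nat.coprime_two_left.2 hp2
    rw [← orderOf_unitOfCoprime_two hc]
    have := Fact.mk hp
    exact orderOf_pos _
  rw [← Finset.card_erase_add_one h1, nu]
  congr 1
  symm
  apply Nat.div_eq_of_eq_mul_left hpos
  omega

/-- With `t = s(p) / 2` one has `2 ^ t = -1` modulo `p`, so the `t`-fold Frobenius sends a root `z`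
of `f` to `z⁻¹`. Thus `z⁻¹` is a root of `f`, so `z` is a common root of the irreducible polynomials
`f` and `f*`. -/
lemma reverse_eq_self_of_even (hp : p.Prime) (hp2 : Odd p) (hs : Even (ordTwo p))
    {f : (ZMod 2)[X]} (hf : f ∈ irredFactors p) : f.reverse = f := by
  have := Fact.mk hp
  obtain ⟨hi, hd⟩ := (mem_irredFactors hp.ne_zero).1 hf
  have := Fact.mk hi
  obtain ⟨t, ht⟩ := hs
  have hpos : 0 < ordTwo p := by
    have hc : Nat.Coprime (2 ^ 1) p := Nat.coprime_two_left.2 hp2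
    rw [← orderOf_unitOfCoprime_two hc]
    exact orderOf_pos _
  have h2t : (2 : ZMod p) ^ t = -1 := by
    have h1 : (2 : ZMod p) ^ t * 2 ^ t = 1 := by
      rw [← pow_add, ← ht, ordTwo, pow_orderOf_eq_one]
    rcases mul_self_eq_one_iff.1 h1 with h | h
    · have := Nat.le_of_dvd (by omega) (orderOf_dvd_of_pow_eq_one h)
      rw [ordTwo] at *
      omega
    · exact h
  have hdvd : p ∣ 2 ^ t + 1 := by
    rw [← ZMod.natCast_eq_zero_iff]
    push_cast
    rw [h2t]; ring
  let z := AdjoinRoot.root f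
  have hz : aeval z f = 0 := by rw [AdjoinRoot.aeval_eq, AdjoinRoot.mk_self]
  have hzp : z ^ p = 1 := by
    have := map_dvd (aeval z) hd
    rw [hz, zero_dvd_iff] at this
    simpa [sub_eq_zero] using this
  have hzi : z ^ 2 ^ t * z = 1 := by
    rw [← pow_succ]
    obtain ⟨k, hk⟩ := hdvd
    rw [hk, pow_mul, hzp, one_pow]
  have hfr : ∀ k, aeval (z ^ 2 ^ k) f = 0 := by
    intro k
    induction k with
    | zero => simpa using hz
    | succ k ih =>
      have := congrArg (aeval (z ^ 2 ^ k)) (ZMod.expand_card f)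
      rw [expand_aeval, map_pow, ih] at this
      rw [pow_succ, pow_mul, this]
      simp
  have hz0 : z ≠ 0 := right_ne_zero_of_mul_eq_one hzi
  -- With `z` as the chosen inverse, the evaluation formula for the reversed polynomial at `⅟(z ^ 2
  -- ^ t)` is literally one at `z`.
  let _ : Invertible (z ^ 2 ^ t) := ⟨z, by rw [mul_comm]; exact hzi, hzi⟩
  have h := eval₂_reverse_mul_pow (algebraMap (ZMod 2) (AdjoinRoot f)) (z ^ 2 ^ t) f
  rw [← aeval_def (z ^ 2 ^ t) f, hfr t] at h
  have hz' : aeval z f.reverse = 0 := by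
    rw [aeval_def]
    exact (mul_eq_zero.1 h).resolve_right (pow_ne_zero _ (pow_ne_zero _ hz0))
  rw [AdjoinRoot.aeval_eq, AdjoinRoot.mk_eq_zero] at hz'
  have hr := ((mem_irredFactors hp.ne_zero).1 (reverse_mem_irredFactors hp.ne_zero hf)).1
  exact (eq_of_monic_of_associated (monic_of_ne_zero_zmodTwo hi.ne_zero)
    (monic_of_ne_zero_zmodTwo hr.ne_zero) (hi.associated_of_dvd hr hz')).symm

/-- The value at `1` is the sum of the coefficients. Those at `k` and `deg f - k` are equal and
cancel in characteristic two, and in odd degree no `k` is paired with itself. -/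
lemma eval_one_eq_zero_of_reverse_eq_self {f : (ZMod 2)[X]} (hf : f.reverse = f)
    (hodd : Odd f.natDegree) : f.eval 1 = 0 := by
  rw [eval_eq_sum_range]
  simp only [one_pow, mul_one]
  refine Finset.sum_involution (fun k _ => f.natDegree - k) ?_ ?_ ?_ ?_
  · intro k hk
    have hk : k ≤ f.natDegree := by simpa [Nat.lt_succ_iff] using hk
    have := coeff_reverse f k
    rw [hf, revAt_le hk] at this
    rw [← this, CharTwo.add_self_eq_zero]
  · intro k hk _ h
    obtain ⟨m, hm⟩ := hodd
    have hk : k ≤ f.natDegree := by simpa [Nat.lt_succ_iff] using hk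
    omega
  · intro k hk
    simp
  · intro k hk
    have hk : k ≤ f.natDegree := by simpa [Nat.lt_succ_iff] using hk
    omega

lemma reverse_ne_self_of_odd (hp : p.Prime) (hp2 : Odd p) (hs : Odd (ordTwo p))
    {f : (ZMod 2)[X]} (hf : f ∈ irredFactors p) (hf1 : f ≠ X - 1) : f.reverse ≠ f := by
  intro h
  have hi := ((mem_irredFactors hp.ne_zero).1 hf).1
  have h1 := eval_one_eq_zero_of_reverse_eq_self h
    ((natDegree_eq_ordTwo hp hp2 hf hf1).symm ▸ hs)
  have h2 : (X - C 1 : (ZMod 2)[X]) ∣ f := dvd_iff_isRoot.2 h1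
  exact hf1 (eq_of_monic_of_associated (monic_of_ne_zero_zmodTwo hi.ne_zero)
    (monic_X_sub_C (1 : ZMod 2)) ((irreducible_X_sub_C (1 : ZMod 2)).associated_of_dvd hi h2).symm)

/-- Each irreducible factor of `X ^ p - 1` is simple. -/
lemma exists_cofactor (hp : Odd p) {f : (ZMod 2)[X]} (hf : f ∈ irredFactors p) :
    ∃ h : (ZMod 2)[X], f * h = X ^ p - 1 ∧ IsCoprime f h := by
  obtain ⟨hi, h, hh⟩ := (mem_irredFactors hp.pos.ne').1 hf
  refine ⟨h, hh.symm, (hi.coprime_iff_not_dvd).2 fun ⟨u, hu⟩ => hi.not_isUnit ?_⟩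
  exact squarefree_X_pow_sub_one hp f ⟨u, by rw [hh, hu]; ring⟩

lemma X_pow_two_mul_sub_one (p : ℕ) : (X ^ (2 * p) - 1 : (ZMod 2)[X]) = (X ^ p - 1) ^ 2 := by
  rw [sub_pow_expChar, one_pow, ← pow_mul, mul_comm]

end Polynomials

/-! ### Torsion modules over `K[X]` and dimensions of kernels. -/

section Modules

open Polynomial

section Regroup

variable {A : Type*} [Ring A] {ι κ : Type} [Finite ι]
  {M : ι → Type*} [∀ i, AddCommGroup (M i)] [∀ i, Module A (M i)]
  {V W : κ → Type*} [∀ j, AddCommGroup (V j)] [∀ j, Module A (V j)]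
  [∀ j, AddCommGroup (W j)] [∀ j, Module A (W j)]

/-- A finite product of modules, each of which is trivial or isomorphic to some `W j` or some
`V j`, is a product of copies of the `W j` and the `V j`. -/
lemma exists_linearEquiv_pi_prod
    (h : ∀ i, Subsingleton (M i) ∨ (∃ j, Nonempty (M i ≃ₗ[A] W j)) ∨
      ∃ j, Nonempty (M i ≃ₗ[A] V j)) :
    ∃ y z : κ → ℕ, Nonempty ((∀ i, M i) ≃ₗ[A]
      ((j : κ) → (Fin (y j) → W j) × (Fin (z j) → V j))) := by
  -- A colour for each factor: `none` for a zero factor, `inl j` for a copy of `W j`, `inr j` for a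
  -- copy of `V j`. The multiplicities are the sizes of the colour classes.
  have h1 : ∀ i, ∃ c : Option (κ ⊕ κ), (c = none → Subsingleton (M i)) ∧
      (∀ j, c = some (.inl j) → Nonempty (M i ≃ₗ[A] W j)) ∧
      (∀ j, c = some (.inr j) → Nonempty (M i ≃ₗ[A] V j)) := by
    intro i
    rcases h i with h | ⟨j, h⟩ | ⟨j, h⟩
    · exact ⟨none, fun _ => h, by simp, by simp⟩
    · exact ⟨some (.inl j), by simp, fun k hk => by cases hk; exact h, by simp⟩
    · exact ⟨some (.inr j), by simp, by simp, fun k hk => by cases hk; exact h⟩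
  choose c h0 hW hV using h1
  let eW : ∀ i j, c i = some (.inl j) → (M i ≃ₗ[A] W j) := fun i j hj => (hW i j hj).some
  let eV : ∀ i j, c i = some (.inr j) → (M i ≃ₗ[A] V j) := fun i j hj => (hV i j hj).some
  let F : (∀ i, M i) →ₗ[A] ((j : κ) → ({i // c i = some (.inl j)} → W j) ×
      ({i // c i = some (.inr j)} → V j)) :=
    LinearMap.pi fun j => LinearMap.prod
      (LinearMap.pi fun i => (eW i j i.2).toLinearMap ∘ₗ LinearMap.proj i.1)
      (LinearMap.pi fun i => (eV i j i.2).toLinearMap ∘ₗ LinearMap.proj i.1)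
  have hF : Function.Bijective F := by
    constructor
    · rw [← LinearMap.ker_eq_bot, LinearMap.ker_eq_bot']
      intro x hx
      funext i
      rcases hc : c i with _ | j | j
      · have := h0 i hc
        exact Subsingleton.elim _ _
      · exact (eW i j hc).map_eq_zero_iff.1 (congrFun (congrArg Prod.fst (congrFun hx j)) ⟨i, hc⟩)
      · exact (eV i j hc).map_eq_zero_iff.1 (congrFun (congrArg Prod.snd (congrFun hx j)) ⟨i, hc⟩)
    · intro t
      have : ∀ i, ∃ m : M i, (∀ j (hj : c i = some (.inl j)), eW i j hj m = (t j).1 ⟨i, hj⟩) ∧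
          ∀ j (hj : c i = some (.inr j)), eV i j hj m = (t j).2 ⟨i, hj⟩ := by
        intro i
        have hcases : c i = none ∨ (∃ j, c i = some (.inl j)) ∨ ∃ j, c i = some (.inr j) := by
          rcases c i with _ | j | j <;> simp
        rcases hcases with hc | ⟨j, hc⟩ | ⟨j, hc⟩
        · exact ⟨0, fun j hj => by simp [hc] at hj, fun j hj => by simp [hc] at hj⟩
        · refine ⟨(eW i j hc).symm ((t j).1 ⟨i, hc⟩), fun k hk => ?_, fun k hk => ?_⟩
          · obtain rfl : j = k := by simpa [hc] using hk
            simp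
          · simp [hc] at hk
        · refine ⟨(eV i j hc).symm ((t j).2 ⟨i, hc⟩), fun k hk => ?_, fun k hk => ?_⟩
          · simp [hc] at hk
          · obtain rfl : j = k := by simpa [hc] using hk
            simp
      choose m hm using this
      refine ⟨m, funext fun j => Prod.ext (funext fun i => ?_) (funext fun i => ?_)⟩
      · exact (hm i).1 j i.2
      · exact (hm i).2 j i.2
  refine ⟨fun j => Nat.card {i // c i = some (.inl j)},
    fun j => Nat.card {i // c i = some (.inr j)}, ⟨(LinearEquiv.ofBijective F hF).trans
      (LinearEquiv.piCongrRight fun j => LinearEquiv.prodCongr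
        (LinearEquiv.funCongrLeft A _ (Finite.equivFin _).symm)
        (LinearEquiv.funCongrLeft A _ (Finite.equivFin _).symm))⟩⟩

end Regroup

section TorsionBy

variable {K : Type*} [Field K] {M N : Type*} [AddCommGroup M] [Module K M] [Module K[X] M]
  [IsScalarTower K K[X] M] [AddCommGroup N] [Module K N] [Module K[X] N] [IsScalarTower K K[X] N]

/-- The dimension of the kernel of the multiplication by a polynomial. -/
def nullity (K : Type*) [Field K] (M : Type*) [AddCommGroup M] [Module K M] [Module K[X] M]
    [IsScalarTower K K[X] M] (q : K[X]) : ℕ :=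
  Module.finrank K (Submodule.torsionBy K[X] M q)

lemma nullity_congr (e : M ≃ₗ[K[X]] N) (q : K[X]) : nullity K M q = nullity K N q := by
  refine LinearEquiv.finrank_eq ((e.submoduleMap _).trans
    (LinearEquiv.ofEq _ (Submodule.torsionBy K[X] N q) ?_) |>.restrictScalars K)
  ext x
  simp only [Submodule.mem_map, Submodule.mem_torsionBy_iff]
  constructor
  · rintro ⟨m, hm, rfl⟩
    simp [← map_smul, hm]
  · intro h
    exact ⟨e.symm x, by rw [← map_smul, h, map_zero], by simp⟩

lemma finiteDimensional_torsionBy [FiniteDimensional K M] (q : K[X]) :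
    FiniteDimensional K (Submodule.torsionBy K[X] M q) :=
  inferInstanceAs (FiniteDimensional K ((Submodule.torsionBy K[X] M q).restrictScalars K))

lemma nullity_prod [FiniteDimensional K M] [FiniteDimensional K N] (q : K[X]) :
    nullity K (M × N) q = nullity K M q + nullity K N q := by
  have := finiteDimensional_torsionBy (M := M) q
  have := finiteDimensional_torsionBy (M := N) q
  rw [nullity, nullity, nullity, ← Module.finrank_prod]
  refine LinearEquiv.finrank_eq
    { toFun := fun x => (⟨x.1.1, congrArg Prod.fst x.2⟩, ⟨x.1.2, congrArg Prod.snd x.2⟩)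
      invFun := fun x => ⟨(x.1.1, x.2.1), Prod.ext x.1.2 x.2.2⟩
      map_add' := fun _ _ => rfl
      map_smul' := fun _ _ => rfl
      left_inv := fun _ => rfl
      right_inv := fun _ => rfl }

lemma nullity_pi {ι : Type*} [Fintype ι] {M : ι → Type*} [∀ i, AddCommGroup (M i)]
    [∀ i, Module K (M i)] [∀ i, Module K[X] (M i)] [∀ i, IsScalarTower K K[X] (M i)]
    [∀ i, FiniteDimensional K (M i)] (q : K[X]) :
    nullity K (∀ i, M i) q = ∑ i, nullity K (M i) q := by
  have := fun i => finiteDimensional_torsionBy (M := M i) q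
  simp only [nullity]
  rw [← Module.finrank_pi_fintype]
  refine LinearEquiv.finrank_eq
    { toFun := fun x i => ⟨x.1 i, congrFun x.2 i⟩
      invFun := fun x => ⟨fun i => (x i).1, funext fun i => (x i).2⟩
      map_add' := fun _ _ => rfl
      map_smul' := fun _ _ => rfl
      left_inv := fun _ => rfl
      right_inv := fun _ => rfl }

lemma nullity_le [FiniteDimensional K M] (q : K[X]) : nullity K M q ≤ Module.finrank K M :=
  Submodule.finrank_le ((Submodule.torsionBy K[X] M q).restrictScalars K)

lemma nullity_of_smul_eq_zero {q : K[X]} (h : ∀ m : M, q • m = 0) :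
    nullity K M q = Module.finrank K M := by
  have : Submodule.torsionBy K[X] M q = ⊤ := by
    rw [eq_top_iff]; exact fun m _ => h m
  rw [nullity, this]
  exact LinearEquiv.finrank_eq (Submodule.topEquiv.restrictScalars K)

end TorsionBy

section Quotient

variable {K : Type*} [Field K]

lemma finiteDimensional_quotient {q : K[X]} (hq : q ≠ 0) :
    FiniteDimensional K (K[X] ⧸ Ideal.span {q}) := by
  rw [← Ideal.span_singleton_mul_left_unit (isUnit_C.2 (isUnit_iff_ne_zero.2
    (inv_ne_zero (leadingCoeff_ne_zero.2 hq)))) q, mul_comm]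
  exact (monic_mul_leadingCoeff_inv hq).finite_quotient

lemma smul_mk_quotient (q a b : K[X]) :
    a • (Ideal.Quotient.mk (Ideal.span {q}) b) = Ideal.Quotient.mk (Ideal.span {q}) (a * b) := rfl

lemma smul_quotient_eq_zero (q : K[X]) (m : K[X] ⧸ Ideal.span {q}) : q • m = 0 := by
  obtain ⟨b, rfl⟩ := Ideal.Quotient.mk_surjective m
  rw [smul_mk_quotient, Ideal.Quotient.eq_zero_iff_mem, Ideal.mem_span_singleton]
  exact dvd_mul_right _ _

lemma dvd_of_smul_quotient_eq_zero {q a : K[X]} (h : ∀ m : K[X] ⧸ Ideal.span {q}, a • m = 0) :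
    q ∣ a := by
  have := h (Ideal.Quotient.mk _ 1)
  rwa [smul_mk_quotient, mul_one, Ideal.Quotient.eq_zero_iff_mem, Ideal.mem_span_singleton] at this

/-- Multiplication by `f * u` on `K[X]/(f ^ 2)` has a kernel of dimension `deg f` when `f` is
coprime to `u`. -/
lemma nullity_quotient_sq {f u : K[X]} (hf : f ≠ 0) (hu : IsCoprime f u) :
    nullity K (K[X] ⧸ Ideal.span {f ^ 2}) (f * u) = f.natDegree := by
  have hle : Ideal.span {f ^ 2} ≤ Ideal.span {f} := by
    rw [Ideal.span_singleton_le_span_singleton]; exact dvd_pow_self f two_ne_zero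
  let φ : (K[X] ⧸ Ideal.span {f ^ 2}) →ₗ[K[X]] (K[X] ⧸ Ideal.span {f}) :=
    Submodule.factor hle
  have hφ : Function.Surjective φ := Submodule.factor_surjective hle
  have hker : LinearMap.ker φ = Submodule.torsionBy K[X] _ (f * u) := by
    ext m
    obtain ⟨b, rfl⟩ := Ideal.Quotient.mk_surjective m
    rw [LinearMap.mem_ker, Submodule.mem_torsionBy_iff, smul_mk_quotient]
    change Ideal.Quotient.mk (Ideal.span {f}) b = 0 ↔ _
    rw [Ideal.Quotient.eq_zero_iff_mem, Ideal.mem_span_singleton, Ideal.Quotient.eq_zero_iff_mem,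
      Ideal.mem_span_singleton, pow_two, mul_assoc, mul_dvd_mul_iff_left hf]
    exact ⟨fun h => h.mul_left u, hu.dvd_of_dvd_mul_left⟩
  have := finiteDimensional_quotient (pow_ne_zero 2 hf)
  have h := LinearMap.finrank_range_add_finrank_ker (φ.restrictScalars K)
  rw [LinearMap.range_eq_top.2 (show Function.Surjective (φ.restrictScalars K) from hφ),
    finrank_top, finrank_quotient_span_eq_natDegree, finrank_quotient_span_eq_natDegree,
    natDegree_pow] at h
  rw [nullity, ← hker]
  change Module.finrank K (LinearMap.ker (φ.restrictScalars K)) = _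
  omega

lemma exists_irreducible_equiv_quotient {M : Type*} [AddCommGroup M] [Module K[X] M]
    [IsSimpleModule K[X] M] {q : K[X]} (hq : q ≠ 0)
    (h0 : ∀ m : M, q • m = 0) :
    ∃ f : K[X], Irreducible f ∧ f ∣ q ∧ Nonempty (M ≃ₗ[K[X]] K[X] ⧸ Ideal.span {f}) := by
  obtain ⟨I, hI, ⟨e⟩⟩ := isSimpleModule_iff_quot_maximal.1 (inferInstance : IsSimpleModule K[X] M)
  obtain ⟨f, rfl⟩ := (IsPrincipalIdealRing.principal I).principal
  have hd : f ∣ q := dvd_of_smul_quotient_eq_zero (K := K) fun m => by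
    obtain ⟨m, rfl⟩ := e.surjective m
    rw [← map_smul, h0, map_zero]
  have hf0 : f ≠ 0 := ne_zero_of_dvd_ne_zero hq hd
  exact ⟨f, ((Ideal.span_singleton_prime hf0).1 hI.isPrime).irreducible, hd, ⟨e⟩⟩

variable {M : Type*} [AddCommGroup M] [Module K M] [Module K[X] M] [IsScalarTower K K[X] M]

/-- The annihilator of a nonzero vector contains the maximal ideal `(f)`, hence equals it, so
`K[X]/(f)` embeds in `M`; equal dimensions make the embedding onto. -/
lemma nonempty_equiv_quotient {f : K[X]} (hf : Irreducible f) (h0 : ∀ m : M, f • m = 0)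
    (hd : Module.finrank K M = f.natDegree) :
    Nonempty (M ≃ₗ[K[X]] K[X] ⧸ Ideal.span {f}) := by
  have hpos : 0 < Module.finrank K M := hd ▸ hf.natDegree_pos
  have := Module.finite_of_finrank_pos hpos
  have := Module.nontrivial_of_finrank_pos hpos
  obtain ⟨m, hm⟩ := exists_ne (0 : M)
  have hker : Ideal.span {f} = LinearMap.ker (LinearMap.toSpanSingleton K[X] M m) := by
    have hmax : (Ideal.span {f}).IsMaximal := PrincipalIdealRing.isMaximal_of_irreducible hf
    refine hmax.eq_of_le ?_ ?_
    · rw [Ne, Ideal.eq_top_iff_one, LinearMap.mem_ker]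
      simpa using hm
    · rw [Ideal.span_singleton_le_iff_mem, LinearMap.mem_ker]
      simpa using h0 m
  let ψ : (K[X] ⧸ Ideal.span {f}) →ₗ[K[X]] M :=
    Submodule.liftQ _ (LinearMap.toSpanSingleton K[X] M m) hker.le
  have hψ : Function.Injective ψ :=
    LinearMap.ker_eq_bot.1 (Submodule.ker_liftQ_eq_bot _ _ _ hker.ge)
  have := finiteDimensional_quotient hf.ne_zero
  have hs : Function.Surjective (ψ.restrictScalars K) :=
    (LinearMap.injective_iff_surjective_of_finrank_eq_finrank
      (by rw [finrank_quotient_span_eq_natDegree, hd])).1 hψ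
  exact ⟨(LinearEquiv.ofBijective ψ ⟨hψ, hs⟩).symm⟩

lemma isSimpleModule_quotient {f : K[X]} (hf : Irreducible f) :
    IsSimpleModule K[X] (K[X] ⧸ Ideal.span {f}) := by
  have hmax : (Ideal.span {f}).IsMaximal := PrincipalIdealRing.isMaximal_of_irreducible hf
  exact isSimpleModule_iff_quot_maximal.2 ⟨_, hmax, ⟨LinearEquiv.refl _ _⟩⟩

lemma exists_linearEquiv_pi_quotient [FiniteDimensional K M] {q : K[X]} (hq : q ≠ 0)
    (h0 : ∀ m : M, q • m = 0) :
    ∃ (ι : Type) (_ : Fintype ι) (f : ι → K[X]) (e : ι → ℕ), (∀ i, Irreducible (f i)) ∧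
      (∀ i, f i ^ e i ∣ q) ∧
      Nonempty (M ≃ₗ[K[X]] ((i : ι) → K[X] ⧸ Ideal.span {f i ^ e i})) := by
  classical
  have : Module.Finite K[X] M := Module.Finite.of_restrictScalars_finite K K[X] M
  have ht : Module.IsTorsion K[X] M := fun {m} => ⟨⟨q, mem_nonZeroDivisors_of_ne_zero hq⟩, h0 m⟩
  obtain ⟨ι, hι, f, hf, e, ⟨E⟩⟩ := Module.equiv_directSum_of_isTorsion ht
  -- Reindexing by `Fin` puts the index type into `Type`.
  let σ := (Fintype.equivFin ι).symm
  let E' : M ≃ₗ[K[X]] ((i : Fin (Fintype.card ι)) → K[X] ⧸ Ideal.span {f (σ i) ^ e (σ i)}) :=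
    (E.trans (DirectSum.linearEquivFunOnFintype K[X] ι _)).trans
      (LinearEquiv.piCongrLeft K[X] (fun i => K[X] ⧸ Ideal.span {f i ^ e i}) σ).symm
  refine ⟨Fin (Fintype.card ι), inferInstance, f ∘ σ, e ∘ σ, fun i => hf _, fun i => ?_, ⟨E'⟩⟩
  refine dvd_of_smul_quotient_eq_zero fun m => ?_
  have h1 : q • E'.symm (Pi.single i m) = 0 := h0 _
  rw [← map_smul, LinearEquiv.map_eq_zero_iff] at h1
  simpa using congrFun h1 i

end Quotient

end Modules

/-! ### Modules over the group algebra of a finite cyclic group, as `k[X]`-modules. -/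

section CyclicGroups

open Polynomial

/-- A chosen generator of a cyclic group. -/
class HasGenerator (G : Type*) [Group G] where
  gen : G
  mem_zpowers_gen : ∀ x : G, x ∈ Subgroup.zpowers gen

open HasGenerator

instance (G : Type*) [Group G] (g : G) : HasGenerator (Subgroup.zpowers g) where
  gen := ⟨g, Subgroup.mem_zpowers g⟩
  mem_zpowers_gen := by
    rintro ⟨x, k, rfl⟩
    exact ⟨k, Subtype.ext (by simp)⟩

section PolynomialAction

variable (k : Type*) [Field k] (G : Type*) [Group G] [HasGenerator G]

/-- The evaluation of polynomials at the generator of a cyclic group. -/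
def polyHom : k[X] →ₐ[k] k[G] := aeval (MonoidAlgebra.of k G gen)

instance groupAlgebraPolyModule : Module k[X] k[G] :=
  Module.compHom _ (polyHom k G).toRingHom

variable {k G}

lemma poly_smul_groupAlgebra (q : k[X]) (r : k[G]) : q • r = polyHom k G q * r := rfl

instance asModulePolyModule {V : Type*} [AddCommGroup V] [Module k V] (ρ : Representation k G V) :
    Module k[X] ρ.asModule :=
  Module.compHom _ (polyHom k G).toRingHom

instance : IsScalarTower k[X] k[G] k[G] := ⟨fun _ _ _ => mul_assoc _ _ _⟩

section Rep

variable {V V' : Type*} [AddCommGroup V] [Module k V] (ρ : Representation k G V)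
  [AddCommGroup V'] [Module k V'] (σ : Representation k G V')

lemma poly_smul_asModule (q : k[X]) (m : ρ.asModule) : q • m = polyHom k G q • m := rfl

lemma asModuleEquiv_poly_smul (q : k[X]) (m : ρ.asModule) :
    ρ.asModuleEquiv (q • m) = aeval (ρ gen) q (ρ.asModuleEquiv m) := by
  rw [poly_smul_asModule, Representation.asModuleEquiv_map_smul, polyHom, ← aeval_algHom_apply,
    Representation.asAlgebraHom_of]

instance : IsScalarTower k[X] k[G] ρ.asModule :=
  ⟨fun q r m => mul_smul (polyHom k G q) r m⟩

instance : IsScalarTower k k[X] ρ.asModule :=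
  ⟨fun c q m => by rw [poly_smul_asModule, map_smul, smul_assoc, poly_smul_asModule]⟩

end Rep

variable [Finite G]

/-- In a finite cyclic group every element is a nonnegative power of the generator. This
surjectivity makes `k[X]`-linearity the same as `k[G]`-linearity, so all module theory can be done
over the principal ideal domain `k[X]`. -/
lemma polyHom_surjective : Function.Surjective (polyHom k G) := by
  intro r
  induction r using MonoidAlgebra.induction_linear with
  | zero => exact ⟨0, map_zero _⟩
  | add x y hx hy =>
    obtain ⟨a, rfl⟩ := hx
    obtain ⟨b, rfl⟩ := hy
    exact ⟨a + b, map_add _ _ _⟩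
  | single x c =>
    obtain ⟨n, rfl⟩ := mem_powers_iff_mem_zpowers.2 (mem_zpowers_gen x)
    refine ⟨C c * X ^ n, ?_⟩
    rw [polyHom, map_mul, aeval_C, map_pow, aeval_X, ← map_pow, MonoidAlgebra.of_apply,
      ← Algebra.smul_def, MonoidAlgebra.smul_single, smul_eq_mul, mul_one]

section ExtendScalars

variable {M N : Type*} [AddCommGroup M] [Module k[X] M] [Module k[G] M]
  [IsScalarTower k[X] k[G] M] [AddCommGroup N] [Module k[X] N] [Module k[G] N]
  [IsScalarTower k[X] k[G] N]

lemma polyHom_smul {G : Type*} [Group G] [HasGenerator G] {M : Type*} [AddCommGroup M]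
    [Module k[X] M] [Module k[G] M] [IsScalarTower k[X] k[G] M] (q : k[X]) (m : M) :
    polyHom k G q • m = q • m := by
  rw [← mul_one (polyHom k G q), ← poly_smul_groupAlgebra, smul_assoc, one_smul]

/-- A `k[X]`-linear map between modules over the group algebra of a cyclic group is linear over
the group algebra. -/
def extendScalars (f : M →ₗ[k[X]] N) : M →ₗ[k[G]] N where
  toFun := f
  map_add' := f.map_add
  map_smul' r m := by
    obtain ⟨q, rfl⟩ := polyHom_surjective r
    rw [polyHom_smul, f.map_smul, RingHom.id_apply, polyHom_smul]

/-- A `k[X]`-linear equivalence between modules over the group algebra of a cyclic group is linear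
over the group algebra. -/
def extendScalarsEquiv (e : M ≃ₗ[k[X]] N) : M ≃ₗ[k[G]] N :=
  { extendScalars (k := k) (G := G) e.toLinearMap, e with }

lemma isSimpleModule_poly_iff : IsSimpleModule k[G] M ↔ IsSimpleModule k[X] M := by
  have : RingHomSurjective (polyHom k G).toRingHom := ⟨polyHom_surjective⟩
  let l : M →ₛₗ[(polyHom k G).toRingHom] M :=
    { toFun := id
      map_add' := fun _ _ => rfl
      map_smul' := fun q m => (polyHom_smul q m).symm }
  exact (LinearMap.isSimpleModule_iff_of_bijective l Function.bijective_id).symm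

end ExtendScalars

lemma X_pow_orderOf_sub_one_smul {G : Type*} [Group G] [HasGenerator G] {M : Type*} [AddCommGroup M] [Module k[X] M] [Module k[G] M]
    [IsScalarTower k[X] k[G] M] (m : M) : (X ^ orderOf (gen : G) - 1 : k[X]) • m = 0 := by
  rw [← polyHom_smul (G := G), polyHom, map_sub, map_pow, aeval_X, map_one, ← map_pow,
    pow_orderOf_eq_one, map_one, sub_self, zero_smul]

section RepEquiv

variable {V V' : Type*} [AddCommGroup V] [Module k V] (ρ : Representation k G V)
  [AddCommGroup V'] [Module k V'] (σ : Representation k G V')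

lemma nonempty_repEquiv_iff : Nonempty (ρ.Equiv σ) ↔ Nonempty (ρ.asModule ≃ₗ[k[X]] σ.asModule) := by
  constructor
  · rintro ⟨φ⟩
    let F := Representation.IntertwiningMap.equivLinearMapAsModule ρ σ φ.toIntertwiningMap
    have hF : Function.Bijective F := φ.toLinearEquiv.bijective
    exact ⟨(LinearEquiv.ofBijective F hF).restrictScalars k[X]⟩
  · rintro ⟨e⟩
    let F := (Representation.IntertwiningMap.equivLinearMapAsModule ρ σ).symm
      (extendScalars (G := G) e.toLinearMap)
    have hF : Function.Bijective F := e.bijective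
    exact ⟨F.ofBijective hF⟩

lemma isIrreducible_of_equiv {f : k[X]} (hf : Irreducible f)
    (e : ρ.asModule ≃ₗ[k[X]] k[X] ⧸ Ideal.span {f}) : ρ.IsIrreducible := by
  rw [Representation.irreducible_iff_isSimpleModule_asModule, isSimpleModule_poly_iff]
  have := isSimpleModule_quotient hf
  exact IsSimpleModule.congr e

end RepEquiv

lemma exists_monoidHom_apply_gen {G : Type*} [Group G] [HasGenerator G] [Finite G]
    {E : Type*} [Monoid E] (t : E) (ht : t ^ orderOf (gen : G) = 1) :
    ∃ φ : G →* E, φ gen = t := by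
  let T := Units.ofPowEqOne t _ ht (orderOf_pos (gen : G)).ne'
  have hT : orderOf T ∣ orderOf (gen : G) := orderOf_dvd_of_pow_eq_one (Units.ext (by
    rw [Units.val_pow_eq_pow_val, Units.val_one]; exact ht))
  refine ⟨(Units.coeHom _).comp (monoidHomOfForallMemZpowers mem_zpowers_gen hT), ?_⟩
  rw [MonoidHom.comp_apply, monoidHomOfForallMemZpowers_apply_gen]
  rfl

/-- Multiplication by `X` on `k[X]/(q)` has order dividing that of the generator, so the generator
may act by it. -/
lemma exists_rep_quotient {q : k[X]} (hq : q ∣ X ^ orderOf (gen : G) - 1) :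
    ∃ ρ : Representation k G (k[X] ⧸ Ideal.span {q}),
      Nonempty (ρ.asModule ≃ₗ[k[X]] k[X] ⧸ Ideal.span {q}) := by
  have hX : Algebra.lsmul k k (k[X] ⧸ Ideal.span {q}) (X : k[X]) ^ orderOf (gen : G) = 1 := by
    rw [← sub_eq_zero, ← map_pow,
      ← map_one (Algebra.lsmul k k (k[X] ⧸ Ideal.span {q}) : k[X] →ₐ[k] _), ← map_sub]
    refine LinearMap.ext fun m => ?_
    obtain ⟨u, hu⟩ := hq
    rw [Algebra.lsmul_coe, hu, mul_comm]
    change (u * q) • m = 0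
    rw [mul_smul, smul_quotient_eq_zero, smul_zero]
  obtain ⟨ρ, hρ⟩ := exists_monoidHom_apply_gen (G := G) _ hX
  have hlin : ∀ (a : k[X]) (m : Representation.asModule ρ),
      Representation.asModuleEquiv ρ (a • m) = a • Representation.asModuleEquiv ρ m := by
    intro a m
    rw [asModuleEquiv_poly_smul, hρ, aeval_algHom_apply, aeval_X_left_apply, Algebra.lsmul_coe]
  exact ⟨ρ, ⟨{ Representation.asModuleEquiv ρ with map_smul' := hlin }⟩⟩

end PolynomialAction

section ProjectiveCover

/-- Uniqueness of projective covers: a lift `φ` of `f` along `f'` is onto because `ker f'` is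
superfluous, hence splits; the section is onto because `ker f` is superfluous. -/
lemma IsProjectiveCover.nonempty_equiv {R P Q M : Type*} [Ring R] [AddCommGroup P] [Module R P]
    [AddCommGroup Q] [Module R Q] [AddCommGroup M] [Module R M]
    (hP : IsProjectiveCover R P M) (hQ : IsProjectiveCover R Q M) : Nonempty (P ≃ₗ[R] Q) := by
  obtain ⟨hP, f, hf, hfs⟩ := hP
  obtain ⟨hQ, f', hf', hfs'⟩ := hQ
  obtain ⟨φ, hφ⟩ := Module.projective_lifting_property f' f hf'
  have hφ' : ∀ x, f' (φ x) = f x := fun x => LinearMap.congr_fun hφ x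
  have hsurj : Function.Surjective φ := by
    rw [← LinearMap.range_eq_top]
    refine hfs' _ (eq_top_iff.2 fun q _ => ?_)
    obtain ⟨x, hx⟩ := hf (f' q)
    rw [← add_sub_cancel (φ x) q]
    refine Submodule.add_mem_sup ⟨x, rfl⟩ ?_
    rw [LinearMap.mem_ker, map_sub, hφ', hx, sub_self]
  obtain ⟨s, hs⟩ := Module.projective_lifting_property φ LinearMap.id hsurj
  have hs' : ∀ x, φ (s x) = x := fun x => LinearMap.congr_fun hs x
  have hrange : LinearMap.range s = ⊤ := by
    refine hfs _ (eq_top_iff.2 fun x _ => ?_)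
    rw [← add_sub_cancel (s (φ x)) x]
    refine Submodule.add_mem_sup ⟨φ x, rfl⟩ ?_
    rw [LinearMap.mem_ker, map_sub, ← hφ' (s (φ x)), hs', hφ', sub_self]
  refine ⟨LinearEquiv.ofBijective φ ⟨fun a b hab => ?_, hsurj⟩⟩
  obtain ⟨a, rfl⟩ := LinearMap.range_eq_top.1 hrange a
  obtain ⟨b, rfl⟩ := LinearMap.range_eq_top.1 hrange b
  rw [hs', hs'] at hab
  rw [hab]

variable {k : Type*} [Field k] {G : Type*} [Group G] [HasGenerator G] [Finite G]
  {P V : Type*} [AddCommGroup P] [Module k[X] P] [Module k[G] P] [IsScalarTower k[X] k[G] P]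
  [AddCommGroup V] [Module k[X] V] [Module k[G] V] [IsScalarTower k[X] k[G] V]

/-- By the Chinese remainder theorem `k[X]/(f ^ 2)` is a direct summand of `k[G]`, hence projective.
The kernel of its map onto `k[X]/(f)` is the image of `f`, and `f ^ 2` acts as zero, so the kernel
is superfluous. -/
lemma isProjectiveCover_of_equiv {f h : k[X]} (hfh : (f * h) ^ 2 = X ^ orderOf (gen : G) - 1)
    (hc : IsCoprime f h) (eP : P ≃ₗ[k[X]] k[X] ⧸ Ideal.span {f ^ 2})
    (eV : V ≃ₗ[k[X]] k[X] ⧸ Ideal.span {f}) : IsProjectiveCover k[G] P V := by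
  constructor
  · obtain ⟨a, b, hab⟩ := hc.pow (m := 2) (n := 2)
    let π : k[G] →ₗ[k[G]] P := LinearMap.toSpanSingleton k[G] P (eP.symm (Ideal.Quotient.mk _ 1))
    -- With `a f ^ 2 + b h ^ 2 = 1`, the element `b h ^ 2` is killed by `f ^ 2` in `k[G]` and is
    -- congruent to `1` modulo `f ^ 2`; sending `1` to it splits `π`.
    let s₀ : (k[X] ⧸ Ideal.span {f ^ 2}) →ₗ[k[X]] k[G] :=
      Submodule.liftQ _ (LinearMap.toSpanSingleton k[X] k[G] ((b * h ^ 2) • (1 : k[G]))) (by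
        rw [Ideal.span_singleton_le_iff_mem, LinearMap.mem_ker, LinearMap.toSpanSingleton_apply,
          smul_smul, show f ^ 2 * (b * h ^ 2) = b * (f * h) ^ 2 by ring, hfh, mul_smul,
          X_pow_orderOf_sub_one_smul, smul_zero])
    let s : P →ₗ[k[G]] k[G] := extendScalars (s₀ ∘ₗ eP.toLinearMap)
    refine Module.Projective.of_split s π (LinearMap.ext fun x => ?_)
    obtain ⟨c, hc⟩ := Ideal.Quotient.mk_surjective (eP x)
    have h1 : s x = (c * (b * h ^ 2)) • (1 : k[G]) := by
      change s₀ (eP x) = _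
      rw [← hc, mul_smul]
      rfl
    change s x • _ = x
    rw [h1, smul_assoc, one_smul, ← map_smul, smul_mk_quotient, LinearEquiv.symm_apply_eq, ← hc,
      mul_one, Ideal.Quotient.eq, Ideal.mem_span_singleton]
    exact ⟨- (c * a), by linear_combination c * hab⟩
  · have hle : Ideal.span {f ^ 2} ≤ Ideal.span {f} := by
      rw [Ideal.span_singleton_le_span_singleton]; exact dvd_pow_self f two_ne_zero
    let φ₀ : (k[X] ⧸ Ideal.span {f ^ 2}) →ₗ[k[X]] (k[X] ⧸ Ideal.span {f}) :=
      Submodule.factor hle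
    have hφ₀ : Function.Surjective φ₀ := Submodule.factor_surjective hle
    let φ : P →ₗ[k[G]] V :=
      extendScalars (eV.symm.toLinearMap ∘ₗ φ₀ ∘ₗ eP.toLinearMap)
    refine ⟨φ, eV.symm.surjective.comp (hφ₀.comp eP.surjective), fun N hN => ?_⟩
    have hker : ∀ x, φ x = 0 → ∃ y, x = f • y := by
      intro x hx
      have hx' : φ₀ (eP x) = 0 := eV.symm.map_eq_zero_iff.1 hx
      obtain ⟨c, hc⟩ := Ideal.Quotient.mk_surjective (eP x)
      rw [← hc] at hx'
      change Ideal.Quotient.mk (Ideal.span {f}) c = 0 at hx'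
      rw [Ideal.Quotient.eq_zero_iff_mem, Ideal.mem_span_singleton] at hx'
      obtain ⟨d, rfl⟩ := hx'
      refine ⟨eP.symm (Ideal.Quotient.mk _ d), ?_⟩
      rw [← map_smul, smul_mk_quotient, hc, LinearEquiv.symm_apply_apply]
    have hsq : ∀ x : P, f • f • x = 0 := by
      intro x
      apply eP.injective
      rw [map_smul, map_smul, smul_smul, ← pow_two, smul_quotient_eq_zero, map_zero]
    have hdec : ∀ x : P, ∃ n ∈ N, ∃ y, x = n + f • y := by
      intro x
      obtain ⟨n, hn, y, hy, rfl⟩ := Submodule.mem_sup.1 (hN ▸ Submodule.mem_top : x ∈ _)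
      obtain ⟨z, rfl⟩ := hker y hy
      exact ⟨n, hn, z, rfl⟩
    -- Applying `P = N + f P` twice gives `x = n + f n' + f ^ 2 y'`, whose last term vanishes.
    refine eq_top_iff.2 fun x _ => ?_
    obtain ⟨n, hn, y, rfl⟩ := hdec x
    obtain ⟨n', hn', y', rfl⟩ := hdec y
    rw [smul_add, hsq, add_zero]
    refine N.add_mem hn ?_
    rw [← polyHom_smul (G := G)]
    exact N.smul_mem _ hn'

end ProjectiveCover

end CyclicGroups

/-! ### Irreducible modules, their duals and projective covers, and the decomposition. -/

section Classification

open Polynomial HasGenerator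

section Reverse

variable {k : Type*} [Field k]

lemma pow_mul_aeval_reflect {S : Type*} [Ring S] [Algebra k S] {a b : S} (hab : a * b = 1)
    (N : ℕ) (f : k[X]) (hf : f.natDegree ≤ N) :
    a ^ N * aeval b (reflect N f) = aeval a f := by
  have hpow : ∀ n, a ^ n * b ^ n = 1 := by
    intro n
    induction n with
    | zero => simp
    | succ n ih => rw [pow_succ, pow_succ', mul_assoc, ← mul_assoc a, hab, one_mul, ih]
  refine induction_with_natDegree_le
    (fun f => a ^ N * aeval b (reflect N f) = aeval a f) N ?_ ?_ ?_ f hf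
  · simp
  · intro n r _ hn
    have h1 : a ^ N * b ^ (N - n) = a ^ n := by
      conv_lhs => rw [← Nat.add_sub_of_le hn, pow_add, Nat.add_sub_cancel_left, mul_assoc, hpow,
        mul_one]
    rw [reflect_C_mul_X_pow, revAt_le hn, map_mul, map_mul, aeval_C, aeval_C, map_pow, map_pow,
      aeval_X, aeval_X, ← mul_assoc, ← Algebra.commutes, mul_assoc, h1]
  · intro f g _ _ hf hg
    rw [reflect_add, map_add, map_add, mul_add, hf, hg]

/-- For `b = a⁻¹` one has `a ^ (deg f) f*(b) = f(a)`, and `a` is injective. -/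
lemma aeval_reverse_apply_eq_zero {M : Type*} [AddCommGroup M] [Module k M] {a b : Module.End k M}
    (hab : a * b = 1) (hba : b * a = 1) {f : k[X]} {v : M} (hv : aeval a f v = 0) :
    aeval b f.reverse v = 0 := by
  have hinj : Function.Injective (a ^ f.natDegree) := by
    rw [Module.End.coe_pow]
    exact Function.Injective.iterate
      (Function.LeftInverse.injective (g := b) fun x => LinearMap.congr_fun hba x) _
  apply hinj
  rw [map_zero, ← Module.End.mul_apply, reverse, pow_mul_aeval_reflect hab _ f le_rfl, hv]

lemma aeval_transpose_apply {M : Type*} [AddCommGroup M] [Module k M] (S : Module.End k M)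
    (q : k[X]) (φ : Module.Dual k M) (v : M) :
    aeval (Module.Dual.transpose (R := k) S : Module.End k (Module.Dual k M)) q φ v =
      φ (aeval S q v) := by
  induction q using Polynomial.induction_on' generalizing φ v with
  | add p q hp hq => simp [hp, hq]
  | monomial n c =>
    rw [aeval_monomial, aeval_monomial]
    simp only [Module.End.mul_apply, Module.algebraMap_end_apply, LinearMap.smul_apply, map_smul]
    congr 1
    induction n generalizing φ with
    | zero => rfl
    | succ n ih =>
      rw [pow_succ, Module.End.mul_apply, ih, pow_succ', Module.End.mul_apply]
      rfl

end Reverse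

section Labelling

variable {k : Type*} [Field k] {G : Type*} [Group G] [HasGenerator G]
  {M : Type*} [AddCommGroup M] [Module k M] (ρ : Representation k G M)

lemma finiteDimensional_of_equiv_quotient {f : k[X]} (hf : f ≠ 0)
    (e : ρ.asModule ≃ₗ[k[X]] k[X] ⧸ Ideal.span {f}) : FiniteDimensional k ρ.asModule := by
  have := finiteDimensional_quotient hf
  exact Module.Finite.equiv (e.symm.restrictScalars k)

/-- On the dual the generator acts by the transpose of its inverse, so `f*` kills the dual. As `f*`
is irreducible of degree equal to the dimension, `nonempty_equiv_quotient` applies. -/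
lemma nonempty_dual_equiv_quotient {f : k[X]} (hf : Irreducible f) (h0 : f.coeff 0 ≠ 0)
    (e : ρ.asModule ≃ₗ[k[X]] k[X] ⧸ Ideal.span {f}) :
    Nonempty (ρ.dual.asModule ≃ₗ[k[X]] k[X] ⧸ Ideal.span {f.reverse}) := by
  have hann : ∀ v : M, aeval (ρ gen) f v = 0 := by
    intro v
    have h1 : f • ρ.asModuleEquiv.symm v = 0 := by
      apply e.injective
      rw [map_smul, smul_quotient_eq_zero, map_zero]
    simpa [asModuleEquiv_poly_smul] using congrArg ρ.asModuleEquiv h1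
  refine nonempty_equiv_quotient (M := ρ.dual.asModule) (irreducible_reverse hf h0) (fun φ => ?_) ?_
  · apply ρ.dual.asModuleEquiv.injective
    rw [asModuleEquiv_poly_smul, map_zero]
    refine LinearMap.ext fun v => ?_
    rw [Representation.dual_apply, aeval_transpose_apply,
      aeval_reverse_apply_eq_zero (a := ρ gen), map_zero, LinearMap.zero_apply]
    · rw [← map_mul, mul_inv_cancel, map_one]
    · rw [← map_mul, inv_mul_cancel, map_one]
    · exact hann v
  · have := finiteDimensional_of_equiv_quotient ρ hf.ne_zero e
    rw [ρ.dual.asModuleEquiv.finrank_eq, Subspace.dual_finrank_eq,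
      natDegree_reverse_of_coeff_zero_ne h0, ← ρ.asModuleEquiv.finrank_eq,
      ← finrank_quotient_span_eq_natDegree, (e.restrictScalars k).finrank_eq]

end Labelling

section Cyclic

variable {G : Type} [Group G] [HasGenerator G] {p : ℕ}

lemma X_pow_sub_one_sq_eq (hord : orderOf (gen : G) = 2 * p) :
    (X ^ p - 1 : (ZMod 2)[X]) ^ 2 = X ^ orderOf (gen : G) - 1 := by
  rw [hord, X_pow_two_mul_sub_one]

lemma dvd_X_pow_orderOf_sub_one (hord : orderOf (gen : G) = 2 * p) {f : (ZMod 2)[X]}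
    (hf : f ∣ X ^ p - 1) : f ∣ X ^ orderOf (gen : G) - 1 := by
  rw [← X_pow_sub_one_sq_eq hord]
  exact dvd_pow hf two_ne_zero

lemma nonempty_trivial_equiv :
    Nonempty ((Representation.trivial (ZMod 2) G (ZMod 2)).asModule ≃ₗ[(ZMod 2)[X]]
      (ZMod 2)[X] ⧸ Ideal.span {(X - 1 : (ZMod 2)[X])}) := by
  refine nonempty_equiv_quotient (irreducible_X_sub_C (1 : ZMod 2)) (fun m => ?_) ?_
  · apply (Representation.trivial (ZMod 2) G (ZMod 2)).asModuleEquiv.injective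
    rw [asModuleEquiv_poly_smul]
    simp
  · rw [(Representation.asModuleEquiv _).finrank_eq, Module.finrank_self]
    exact (natDegree_X_sub_C (1 : ZMod 2)).symm

/-- Kernel dimensions are additive over direct sums. They carry all the information about the
multiplicities that is used, so no uniqueness of decompositions is needed. -/
lemma HasDecomposition.nullity_eq {m : ℕ} {V W : Fin (m + 1) → Rep.{0} (ZMod 2) G}
    {M : Type} [AddCommGroup M] [Module (ZMod 2) M] {ρ : Representation (ZMod 2) G M}
    {y z : Fin (m + 1) → ℕ} (h : HasDecomposition ρ V W y z)
    (hV : ∀ i, FiniteDimensional (ZMod 2) (V i).ρ.asModule)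
    (hW : ∀ i, FiniteDimensional (ZMod 2) (W i).ρ.asModule) (q : (ZMod 2)[X]) :
    nullity (ZMod 2) ρ.asModule q =
      ∑ i, (y i * nullity (ZMod 2) (W i).ρ.asModule q +
        z i * nullity (ZMod 2) (V i).ρ.asModule q) := by
  rw [nullity_congr (h.some.restrictScalars (ZMod 2)[X]), nullity_pi]
  refine Finset.sum_congr rfl fun i _ => ?_
  rw [nullity_prod, nullity_pi, nullity_pi]
  simp

variable [Finite G]

lemma exists_mem_irredFactors_equiv (hp : p ≠ 0) (hord : orderOf (gen : G) = 2 * p)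
    {M : Type} [AddCommGroup M] [Module (ZMod 2) M] (ρ : Representation (ZMod 2) G M)
    (hρ : ρ.IsIrreducible) : ∃ f ∈ irredFactors p,
      Nonempty (ρ.asModule ≃ₗ[(ZMod 2)[X]] (ZMod 2)[X] ⧸ Ideal.span {f}) := by
  rw [Representation.irreducible_iff_isSimpleModule_asModule, isSimpleModule_poly_iff] at hρ
  have hne : (X ^ orderOf (gen : G) - 1 : (ZMod 2)[X]) ≠ 0 := by
    rw [← X_pow_sub_one_sq_eq hord]; exact pow_ne_zero _ (X_pow_sub_one_ne_zero' hp)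
  obtain ⟨f, hf, hd, e⟩ := exists_irreducible_equiv_quotient (M := ρ.asModule) hne
    (X_pow_orderOf_sub_one_smul (G := G))
  rw [← X_pow_sub_one_sq_eq hord] at hd
  exact ⟨f, (mem_irredFactors hp).2 ⟨hf, hf.prime.dvd_of_dvd_pow hd⟩, e⟩

lemma eq_of_equiv_quotient (hp : p ≠ 0) {f f' : (ZMod 2)[X]} (hf : f ∈ irredFactors p)
    (hf' : f' ∈ irredFactors p)
    (e : ((ZMod 2)[X] ⧸ Ideal.span {f}) ≃ₗ[(ZMod 2)[X]] (ZMod 2)[X] ⧸ Ideal.span {f'}) :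
    f = f' := by
  have hd : f' ∣ f := dvd_of_smul_quotient_eq_zero fun m => by
    obtain ⟨m, rfl⟩ := e.surjective m
    rw [← map_smul, smul_quotient_eq_zero, map_zero]
  have hi := ((mem_irredFactors hp).1 hf).1
  have hi' := ((mem_irredFactors hp).1 hf').1
  exact eq_of_monic_of_associated (monic_of_ne_zero_zmodTwo hi.ne_zero)
    (monic_of_ne_zero_zmodTwo hi'.ne_zero) (hi'.associated_of_dvd hi hd).symm

lemma exists_numbering (hp : p.Prime) (hp2 : Odd p) (hord : orderOf (gen : G) = 2 * p) :
    ∃ V W : Fin (nu p + 1) → Rep.{0} (ZMod 2) G, IsNumberingOfIrreducibles G (nu p) V ∧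
      ∀ i, IsProjectiveCover (MonoidAlgebra (ZMod 2) G) (W i).ρ.asModule (V i).ρ.asModule := by
  let e₀ : Fin (nu p + 1) ≃ irredFactors p := (Finset.equivFinOfCardEq (card_irredFactors hp hp2)).symm
  let a : irredFactors p := ⟨X - 1, X_sub_one_mem_irredFactors hp.ne_zero⟩
  -- The swap puts `X - 1`, the polynomial of the trivial module, at index `0`.
  let e : Fin (nu p + 1) ≃ irredFactors p := e₀.trans (Equiv.swap (e₀ 0) a)
  have he0 : e 0 = a := Equiv.swap_apply_left _ _
  have hmem : ∀ i, Irreducible (e i).1 ∧ (e i).1 ∣ X ^ p - 1 :=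
    fun i => (mem_irredFactors hp.ne_zero).1 (e i).2
  have hV : ∀ i, ∃ ρ : Representation (ZMod 2) G ((ZMod 2)[X] ⧸ Ideal.span {(e i).1}),
      Nonempty (ρ.asModule ≃ₗ[(ZMod 2)[X]] (ZMod 2)[X] ⧸ Ideal.span {(e i).1}) := fun i =>
    exists_rep_quotient (dvd_X_pow_orderOf_sub_one hord (hmem i).2)
  have hW : ∀ i, ∃ ρ : Representation (ZMod 2) G ((ZMod 2)[X] ⧸ Ideal.span {(e i).1 ^ 2}),
      Nonempty (ρ.asModule ≃ₗ[(ZMod 2)[X]] (ZMod 2)[X] ⧸ Ideal.span {(e i).1 ^ 2}) := fun i =>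
    exists_rep_quotient (X_pow_sub_one_sq_eq hord ▸ pow_dvd_pow_of_dvd (hmem i).2 2)
  choose ρ hρ using hV
  choose σ hσ using hW
  refine ⟨fun i => Rep.of (ρ i), fun i => Rep.of (σ i), ⟨fun i => ?_, fun i j hij => ?_,
    fun U hU => ?_, ?_⟩, fun i => ?_⟩
  · exact isIrreducible_of_equiv (ρ i) (hmem i).1 (hρ i).some
  · obtain ⟨E⟩ := (nonempty_repEquiv_iff _ _).1 hij
    exact e.injective (Subtype.ext (eq_of_equiv_quotient hp.ne_zero (e i).2 (e j).2
      ((hρ i).some.symm.trans (E.trans (hρ j).some))))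
  · obtain ⟨f, hf, ⟨E⟩⟩ := exists_mem_irredFactors_equiv hp.ne_zero hord U.ρ hU
    obtain ⟨i, hi⟩ := e.surjective ⟨f, hf⟩
    obtain rfl : (e i).1 = f := congrArg Subtype.val hi
    exact ⟨i, (nonempty_repEquiv_iff _ _).2 ⟨E.trans (hρ i).some.symm⟩⟩
  · refine (nonempty_repEquiv_iff _ _).2 ?_
    obtain ⟨E⟩ := nonempty_trivial_equiv (G := G)
    have h0 : (X - 1 : (ZMod 2)[X]) = (e 0).1 := (congrArg Subtype.val he0).symm
    rw [h0] at E
    exact ⟨(hρ 0).some.trans E.symm⟩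
  · obtain ⟨h, hh, hc⟩ := exists_cofactor hp2 (e i).2
    exact isProjectiveCover_of_equiv (by rw [hh, X_pow_sub_one_sq_eq hord]) hc
      (hσ i).some (hρ i).some

variable {m : ℕ} {V W : Fin (m + 1) → Rep.{0} (ZMod 2) G}

lemma IsNumberingOfIrreducibles.exists_labelling (hV : IsNumberingOfIrreducibles G m V)
    (hp : p.Prime) (hord : orderOf (gen : G) = 2 * p) :
    ∃ F : Fin (m + 1) → (ZMod 2)[X], F 0 = X - 1 ∧ Function.Injective F ∧
      (∀ f, f ∈ irredFactors p ↔ ∃ i, F i = f) ∧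
      ∀ i, Nonempty ((V i).ρ.asModule ≃ₗ[(ZMod 2)[X]] (ZMod 2)[X] ⧸ Ideal.span {F i}) := by
  choose F hF e using fun i => exists_mem_irredFactors_equiv hp.ne_zero hord _ (hV.irreducible i)
  refine ⟨F, ?_, fun i j hij => ?_, fun f => ⟨fun hf => ?_, ?_⟩, e⟩
  · obtain ⟨E⟩ := nonempty_trivial_equiv (G := G)
    obtain ⟨E'⟩ := (nonempty_repEquiv_iff _ _).1 hV.trivial
    exact eq_of_equiv_quotient hp.ne_zero (hF 0) (X_sub_one_mem_irredFactors hp.ne_zero)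
      ((e 0).some.symm.trans (E'.trans E))
  · refine hV.injective i j ((nonempty_repEquiv_iff _ _).2 ?_)
    have h1 := e i
    rw [hij] at h1
    exact ⟨h1.some.trans (e j).some.symm⟩
  · obtain ⟨hi, hd⟩ := (mem_irredFactors hp.ne_zero).1 hf
    obtain ⟨ρ, ⟨E⟩⟩ := exists_rep_quotient (dvd_X_pow_orderOf_sub_one hord hd)
    obtain ⟨i, hi⟩ := hV.complete (Rep.of ρ) (isIrreducible_of_equiv ρ hi E)
    obtain ⟨E'⟩ := (nonempty_repEquiv_iff _ _).1 hi
    exact ⟨i, eq_of_equiv_quotient hp.ne_zero (hF i) hf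
      ((e i).some.symm.trans (E'.symm.trans E))⟩
  · rintro ⟨i, rfl⟩
    exact hF i

lemma IsProjectiveCover.nonempty_equiv_quotient_sq (hp2 : Odd p)
    (hord : orderOf (gen : G) = 2 * p) {f : (ZMod 2)[X]} (hf : f ∈ irredFactors p)
    {P U : Rep.{0} (ZMod 2) G}
    (hU : Nonempty (U.ρ.asModule ≃ₗ[(ZMod 2)[X]] (ZMod 2)[X] ⧸ Ideal.span {f}))
    (hP : IsProjectiveCover (MonoidAlgebra (ZMod 2) G) P.ρ.asModule U.ρ.asModule) :
    Nonempty (P.ρ.asModule ≃ₗ[(ZMod 2)[X]] (ZMod 2)[X] ⧸ Ideal.span {f ^ 2}) := by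
  obtain ⟨h, hh, hc⟩ := exists_cofactor hp2 hf
  obtain ⟨σ, ⟨E⟩⟩ := exists_rep_quotient (k := ZMod 2) (G := G) (q := f ^ 2)
    (by rw [← X_pow_sub_one_sq_eq hord, ← hh, mul_pow]; exact dvd_mul_right _ _)
  have hσ : IsProjectiveCover (MonoidAlgebra (ZMod 2) G) σ.asModule U.ρ.asModule :=
    isProjectiveCover_of_equiv (by rw [hh, X_pow_sub_one_sq_eq hord]) hc E hU.some
  obtain ⟨E'⟩ := hP.nonempty_equiv hσ
  exact ⟨(E'.restrictScalars (ZMod 2)[X]).trans E⟩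

variable {F : Fin (m + 1) → (ZMod 2)[X]}
  {M : Type} [AddCommGroup M] [Module (ZMod 2) M] {ρ : Representation (ZMod 2) G M}

lemma exists_hasDecomposition (hp : p.Prime) (hp2 : Odd p) (hord : orderOf (gen : G) = 2 * p)
    [FiniteDimensional (ZMod 2) M]
    (hF : ∀ f, f ∈ irredFactors p ↔ ∃ i, F i = f)
    (eV : ∀ i, Nonempty ((V i).ρ.asModule ≃ₗ[(ZMod 2)[X]] (ZMod 2)[X] ⧸ Ideal.span {F i}))
    (eW : ∀ i, Nonempty ((W i).ρ.asModule ≃ₗ[(ZMod 2)[X]] (ZMod 2)[X] ⧸ Ideal.span {F i ^ 2})) :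
    ∃ y z : Fin (m + 1) → ℕ, HasDecomposition ρ V W y z := by
  have hne : (X ^ orderOf (gen : G) - 1 : (ZMod 2)[X]) ≠ 0 := by
    rw [← X_pow_sub_one_sq_eq hord]; exact pow_ne_zero _ (X_pow_sub_one_ne_zero' hp.ne_zero)
  obtain ⟨ι, hι, f, e, hf, hd, ⟨E⟩⟩ := exists_linearEquiv_pi_quotient (M := ρ.asModule) hne
    (X_pow_orderOf_sub_one_smul (G := G))
  obtain ⟨y, z, ⟨E'⟩⟩ := exists_linearEquiv_pi_prod (A := (ZMod 2)[X])
    (M := fun i => (ZMod 2)[X] ⧸ Ideal.span {f i ^ e i}) (V := fun j => (V j).ρ.asModule)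
    (W := fun j => (W j).ρ.asModule) (fun i => by
      rcases Nat.eq_zero_or_pos (e i) with h0 | hpos
      · left
        rw [h0, pow_zero, Ideal.span_singleton_one]
        exact Ideal.Quotient.subsingleton_iff.2 rfl
      right
      have hdi := hd i
      rw [← X_pow_sub_one_sq_eq hord] at hdi
      have hfd : f i ∣ X ^ p - 1 :=
        (hf i).prime.dvd_of_dvd_pow ((dvd_pow_self _ hpos.ne').trans hdi)
      have hmem : f i ∈ irredFactors p := (mem_irredFactors hp.ne_zero).2 ⟨hf i, hfd⟩
      obtain ⟨j, hj⟩ := (hF _).1 hmem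
      -- A cube `f ^ 3` dividing `(f h) ^ 2` would force `f ∣ h ^ 2`, against the coprimality of `f`
      -- and `h`.
      have hle : e i ≤ 2 := by
        by_contra hgt
        obtain ⟨h, hh, hc⟩ := exists_cofactor hp2 hmem
        have h3 : f i ^ 2 * f i ∣ f i ^ 2 * h ^ 2 := by
          rw [← pow_succ, ← mul_pow, hh]
          exact (pow_dvd_pow _ (by omega)).trans hdi
        have h4 := (mul_dvd_mul_iff_left (pow_ne_zero 2 (hf i).ne_zero)).1 h3
        exact (hf i).not_isUnit (hc.pow_right.isUnit_of_dvd' dvd_rfl h4)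
      obtain h1 | h1 : e i = 1 ∨ e i = 2 := by omega
      · right
        refine ⟨j, ?_⟩
        rw [h1, pow_one, ← hj]
        exact ⟨(eV j).some.symm⟩
      · left
        refine ⟨j, ?_⟩
        rw [h1, ← hj]
        exact ⟨(eW j).some.symm⟩)
  exact ⟨y, z, ⟨extendScalarsEquiv (E.trans E')⟩⟩

end Cyclic

end Classification

/-! ### Orthogonality in `F_2 ^ n` and the cycles of `g`. -/

section Codes

open Polynomial HasGenerator

section Duality

variable {n : ℕ}

lemma mem_dualCode {C : Code n} {v : Fin n → ZMod 2} :
    v ∈ dualCode C ↔ ∀ c ∈ C, v ⬝ᵥ c = 0 := Iff.rfl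

lemma finrank_add_finrank_dualCode (C : Code n) :
    Module.finrank (ZMod 2) C + Module.finrank (ZMod 2) (dualCode C) = n := by
  let B : LinearMap.BilinForm (ZMod 2) (Fin n → ZMod 2) := dotProductBilin (ZMod 2) (ZMod 2)
  have hB : B.Nondegenerate := by
    constructor
    · intro v hv
      exact dotProduct_eq_zero v hv
    · intro v hv
      exact dotProduct_eq_zero v fun w => (dotProduct_comm v w).trans (hv w)
  have h := LinearMap.BilinForm.finrank_orthogonal hB C
  have hC : B.orthogonal C = dualCode C := by
    ext v
    rw [LinearMap.BilinForm.mem_orthogonal_iff, mem_dualCode]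
    exact forall₂_congr fun c _ => by rw [dotProduct_comm]; rfl
  rw [hC, Module.finrank_fin_fun] at h
  have := Submodule.finrank_le C
  rw [Module.finrank_fin_fun] at this
  omega

lemma IsSelfDual.two_mul_finrank {C : Code n} (hC : IsSelfDual C) :
    2 * Module.finrank (ZMod 2) C = n := by
  have := finrank_add_finrank_dualCode C
  rw [← hC] at this
  omega

lemma permRep_apply (σ : Equiv.Perm (Fin n)) (v : Fin n → ZMod 2) (i : Fin n) :
    permRep n σ v i = v (σ⁻¹ i) := rfl

lemma permRep_single (σ : Equiv.Perm (Fin n)) (i : Fin n) :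
    permRep n σ (Pi.single i 1) = Pi.single (σ i) 1 := by
  ext j
  have h : σ⁻¹ j = i ↔ j = σ i := Equiv.Perm.inv_eq_iff_eq
  simp only [permRep_apply, Pi.single_apply, h]

lemma permRep_dotProduct (σ : Equiv.Perm (Fin n)) (u v : Fin n → ZMod 2) :
    permRep n σ u ⬝ᵥ v = u ⬝ᵥ permRep n σ⁻¹ v := by
  simp only [dotProduct, permRep_apply, inv_inv]
  exact Fintype.sum_equiv σ⁻¹ _ _ fun i => by simp

lemma aeval_permRep_dotProduct (σ : Equiv.Perm (Fin n)) (q : (ZMod 2)[X]) (u v : Fin n → ZMod 2) :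
    aeval (permRep n σ) q u ⬝ᵥ v = u ⬝ᵥ aeval (permRep n σ⁻¹) q v := by
  induction q using Polynomial.induction_on' with
  | add p q hp hq => simp only [map_add, LinearMap.add_apply, add_dotProduct, dotProduct_add, hp, hq]
  | monomial k c =>
    rw [aeval_monomial, aeval_monomial, ← map_pow, ← map_pow, Module.End.mul_apply,
      Module.End.mul_apply, Module.algebraMap_end_apply, Module.algebraMap_end_apply,
      smul_dotProduct, dotProduct_smul, permRep_dotProduct, inv_pow]

/-- The part of a self-dual code annihilated by `f(g)` is bounded by means of the image of `f*(g)`,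
where `f*` is the reciprocal polynomial. -/
lemma IsSelfDual.finrank_inf_ker_add_le {C : Code n} (hC : IsSelfDual C) (g : Equiv.Perm (Fin n))
    (f : (ZMod 2)[X]) :
    Module.finrank (ZMod 2) (C ⊓ LinearMap.ker (aeval (permRep n g) f) : Code n) +
        Module.finrank (ZMod 2) (LinearMap.range (aeval (permRep n g) f.reverse)) ≤
      Module.finrank (ZMod 2) C +
        Module.finrank (ZMod 2) (C ⊓ LinearMap.range (aeval (permRep n g) f.reverse) : Code n) := by
  have h1 := Submodule.finrank_sup_add_finrank_inf_eq C
    (LinearMap.range (aeval (permRep n g) f.reverse))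
  have h2 := finrank_add_finrank_dualCode (C ⊔ LinearMap.range (aeval (permRep n g) f.reverse))
  have h3 := hC.two_mul_finrank
  -- A vector `u` of `C` is orthogonal to `C` by self-duality. Its product with `f*(g) w` moves
  -- `f*(g⁻¹)` onto `u`, and this kills `u` when `f(g)` does.
  have h4 : C ⊓ LinearMap.ker (aeval (permRep n g) f) ≤
      dualCode (C ⊔ LinearMap.range (aeval (permRep n g) f.reverse)) := by
    rintro u ⟨hu, hk⟩ v hv
    obtain ⟨c, hc, _, ⟨w, rfl⟩, rfl⟩ := Submodule.mem_sup.1 hv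
    have hu' : u ∈ dualCode C := hC ▸ hu
    rw [dotProduct_add, hu' c hc, zero_add, dotProduct_comm, aeval_permRep_dotProduct,
      aeval_reverse_apply_eq_zero (a := permRep n g) _ _ hk, dotProduct_zero]
    · rw [← map_mul, mul_inv_cancel, map_one]
    · rw [← map_mul, inv_mul_cancel, map_one]
  have h5 := Submodule.finrank_mono h4
  omega

end Duality

section Cycles

variable {n : ℕ}

/-- The cokernel of `f(g)` is generated over `F_2[X]` by the classes of the basis vectors at points
of `S`. It is killed by `f`, so each generator contributes dimension at most `deg f`, by division
with remainder. -/
lemma le_finrank_range_add (g : Equiv.Perm (Fin n)) {f : (ZMod 2)[X]} (hf : f.Monic)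
    (hf1 : f ≠ 1) (S : Finset (Fin n))
    (hS : ∀ k, (∃ a ∈ S, ∃ j : ℕ, (g ^ j) a = k) ∨
      (Pi.single k 1 : Fin n → ZMod 2) ∈ LinearMap.range (aeval (permRep n g) f)) :
    n ≤ Module.finrank (ZMod 2) (LinearMap.range (aeval (permRep n g) f)) +
      f.natDegree * S.card := by
  let b : S × Fin f.natDegree → (Fin n → ZMod 2) :=
    fun x => permRep n (g ^ (x.2 : ℕ)) (Pi.single x.1.1 1)
  have hpow : ∀ (a : Fin n) (j : ℕ), (Pi.single ((g ^ j) a) 1 : Fin n → ZMod 2) =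
      aeval (permRep n g) (X ^ j : (ZMod 2)[X]) (Pi.single a 1) := by
    intro a j
    rw [map_pow, aeval_X, ← map_pow, permRep_single]
  have htop : LinearMap.range (aeval (permRep n g) f) ⊔ Submodule.span (ZMod 2) (Set.range b) =
      ⊤ := by
    rw [eq_top_iff, ← (Pi.basisFun (ZMod 2) (Fin n)).span_eq, Submodule.span_le]
    rintro _ ⟨k, rfl⟩
    rw [Pi.basisFun_apply]
    rcases hS k with ⟨a, ha, j, rfl⟩ | hk
    · rw [hpow, ← modByMonic_add_div (X ^ j : (ZMod 2)[X]) f, map_add, LinearMap.add_apply]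
      refine Submodule.add_mem _ ?_ ?_
      · refine Submodule.mem_sup_right ?_
        rw [aeval_eq_sum_range' (natDegree_modByMonic_lt _ hf hf1), LinearMap.sum_apply]
        refine Submodule.sum_mem _ fun i hi => Submodule.smul_mem _ _ (Submodule.subset_span ?_)
        exact ⟨(⟨a, ha⟩, ⟨i, Finset.mem_range.1 hi⟩), by simp only [b, map_pow]⟩
      · refine Submodule.mem_sup_left ?_
        rw [map_mul, Module.End.mul_apply]
        exact ⟨_, rfl⟩
    · exact Submodule.mem_sup_left hk
  have h1 := Submodule.finrank_add_le_finrank_add_finrank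
    (LinearMap.range (aeval (permRep n g) f)) (Submodule.span (ZMod 2) (Set.range b))
  have h2 : Module.finrank (ZMod 2) (Submodule.span (ZMod 2) (Set.range b)) ≤ _ :=
    finrank_range_le_card (R := ZMod 2) b
  rw [htop, finrank_top, Module.finrank_fin_fun] at h1
  rw [Fintype.card_prod, Fintype.card_coe, Fintype.card_fin, mul_comm] at h2
  omega

variable {g : Equiv.Perm (Fin n)} {p : ℕ}

/-- Cycle lengths divide `2p`; an odd one would divide `p`, and then `g ^ p` would fix the points of
that cycle. -/
lemma card_support_cycle (hp : p.Prime) (hord : orderOf g = 2 * p)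
    (hfix : ∀ k : Fin n, (g ^ p) k ≠ k) {c : Equiv.Perm (Fin n)}
    (hc : c ∈ g.cycleFactorsFinset) : c.support.card = 2 * p ∨ c.support.card = 2 := by
  have hmem : c.support.card ∈ g.cycleType := by
    rw [Equiv.Perm.cycleType_def]
    exact Multiset.mem_map_of_mem _ hc
  have hd := Equiv.Perm.dvd_of_mem_cycleType hmem
  have hcyc := (Equiv.Perm.mem_cycleFactorsFinset_iff.1 hc).1
  rw [hord] at hd
  rcases Nat.even_or_odd c.support.card with ⟨t, ht⟩ | hodd
  · rw [ht, ← two_mul] at hd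
    rcases (Nat.dvd_prime hp).1 (Nat.dvd_of_mul_dvd_mul_left two_pos hd) with h | h
    · right; omega
    · left; omega
  · exfalso
    have hdp : c.support.card ∣ p := (Nat.coprime_two_right.2 hodd).dvd_of_dvd_mul_left hd
    obtain ⟨k, hk⟩ := hcyc.nonempty_support
    have h1 : c ^ p = 1 := by
      rw [← orderOf_dvd_iff_pow_eq_one, hcyc.orderOf]; exact hdp
    apply hfix k
    rw [← Equiv.Perm.cycleOf_pow_apply_self, ← Equiv.Perm.cycle_is_cycleOf hk hc, h1]
    rfl

lemma eq_two_mul_numCycles (hp : p.Prime) (hord : orderOf g = 2 * p)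
    (hfix : ∀ k : Fin n, (g ^ p) k ≠ k) : n = 2 * (p * numCycles g (2 * p) + numCycles g 2) := by
  have hsupp : g.support = Finset.univ := by
    refine Finset.eq_univ_of_forall fun k => Equiv.Perm.mem_support.2 fun h => hfix k ?_
    rw [Equiv.Perm.coe_pow]
    exact Function.iterate_fixed h p
  have h1 := g.sum_cycleType
  have hne : 2 * p ≠ 2 := by have := hp.two_le; omega
  rw [hsupp, Finset.card_univ, Fintype.card_fin,
    Finset.sum_multiset_count_of_subset _ {2 * p, 2}, Finset.sum_pair hne] at h1
  · simp only [smul_eq_mul] at h1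
    rw [numCycles, numCycles]
    linarith
  · intro m hm
    rw [Multiset.mem_toFinset, Equiv.Perm.cycleType_def, Multiset.mem_map] at hm
    obtain ⟨c, hc, rfl⟩ := hm
    simpa using card_support_cycle hp hord hfix hc

lemma card_filter_cycleFactorsFinset (m : ℕ) :
    (g.cycleFactorsFinset.filter fun c => c.support.card = m).card = numCycles g m := by
  rw [numCycles, Equiv.Perm.cycleType_def, Multiset.count_map, ← Finset.filter_val]
  simp only [Function.comp_apply, eq_comm (a := m)]
  rfl

/-- One representative per cycle always suffices in `le_finrank_range_add`. For `f ≠ X - 1` the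
`2`-cycles need none: `(X - 1) ^ 2` kills their basis vectors and `f` is coprime to it, so these
vectors lie in the image of `f(g)`. -/
lemma le_finrank_range_add_of_irreducible (hp : p.Prime) (hord : orderOf g = 2 * p)
    (hfix : ∀ k : Fin n, (g ^ p) k ≠ k) {f : (ZMod 2)[X]} (hf : Irreducible f) :
    n ≤ Module.finrank (ZMod 2) (LinearMap.range (aeval (permRep n g) f)) +
      f.natDegree * (if f = X - 1 then numCycles g (2 * p) + numCycles g 2
        else numCycles g (2 * p)) := by
  have hm := monic_of_ne_zero_zmodTwo hf.ne_zero
  have hf1 : f ≠ 1 := fun h => hf.not_isUnit (h ▸ isUnit_one)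
  have hg : ∀ k, g k ≠ k := fun k h => hfix k (by
    rw [Equiv.Perm.coe_pow]
    exact Function.iterate_fixed h p)
  have hrep : ∀ c : g.cycleFactorsFinset, ∃ a, a ∈ c.1.support := fun c =>
    (Equiv.Perm.mem_cycleFactorsFinset_iff.1 c.2).1.nonempty_support
  choose a ha using hrep
  let a' : Equiv.Perm (Fin n) → Fin n → Fin n := fun c k =>
    if h : c ∈ g.cycleFactorsFinset then a ⟨c, h⟩ else k
  have hcyc : ∀ k, g.cycleOf k ∈ g.cycleFactorsFinset := fun k =>
    Equiv.Perm.cycleOf_mem_cycleFactorsFinset_iff.2 (Equiv.Perm.mem_support.2 (hg k))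
  have hreach : ∀ k, ∃ j : ℕ, (g ^ j) (a ⟨g.cycleOf k, hcyc k⟩) = k := fun k =>
    (Equiv.Perm.mem_support_cycleOf_iff.1 (ha ⟨g.cycleOf k, hcyc k⟩)).1.symm.exists_nat_pow_eq
  have hne : 2 * p ≠ 2 := by have := hp.two_le; omega
  split_ifs with h1
  · have hcard : (Finset.univ.image a).card ≤ numCycles g (2 * p) + numCycles g 2 := by
      refine Finset.card_image_le.trans ?_
      rw [Finset.card_univ, Fintype.card_coe, ← card_filter_cycleFactorsFinset,
        ← card_filter_cycleFactorsFinset]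
      refine (Finset.card_le_card fun c hc => ?_).trans (Finset.card_union_le _ _)
      rw [Finset.mem_union, Finset.mem_filter, Finset.mem_filter]
      exact (card_support_cycle hp hord hfix hc).imp (fun h => ⟨hc, h⟩) fun h => ⟨hc, h⟩
    refine (le_finrank_range_add g hm hf1 (Finset.univ.image a) fun k => Or.inl ?_).trans
      (by gcongr)
    exact ⟨_, Finset.mem_image_of_mem a (Finset.mem_univ _), hreach k⟩
  · let S := Finset.univ.filter fun c : g.cycleFactorsFinset => c.1.support.card = 2 * p
    have hcard : (S.image a).card ≤ numCycles g (2 * p) := by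
      refine Finset.card_image_le.trans ?_
      rw [← card_filter_cycleFactorsFinset, ← Finset.card_map (Function.Embedding.subtype _)]
      refine Finset.card_le_card fun c hc => ?_
      simp only [S, Finset.mem_map, Finset.mem_filter] at hc
      obtain ⟨d, ⟨-, hd⟩, rfl⟩ := hc
      exact Finset.mem_filter.2 ⟨d.2, hd⟩
    refine (le_finrank_range_add g hm hf1 (S.image a) fun k => ?_).trans (by gcongr)
    rcases card_support_cycle hp hord hfix (hcyc k) with h | h
    · exact Or.inl ⟨_, Finset.mem_image_of_mem a
        (Finset.mem_filter.2 ⟨Finset.mem_univ ⟨g.cycleOf k, hcyc k⟩, h⟩), hreach k⟩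
    · right
      have h2 : (g ^ 2) k = k := by
        have : g.cycleOf k ^ 2 = 1 := by
          rw [← h, ← (Equiv.Perm.mem_cycleFactorsFinset_iff.1 (hcyc k)).1.orderOf,
            pow_orderOf_eq_one]
        rw [← Equiv.Perm.cycleOf_pow_apply_self, this]
        rfl
      have h3 : aeval (permRep n g) ((X - 1) ^ 2 : (ZMod 2)[X]) (Pi.single k 1) = 0 := by
        rw [sub_pow_expChar, one_pow, map_sub, map_pow, aeval_X, map_one, ← map_pow,
          LinearMap.sub_apply, permRep_single, h2, Module.End.one_apply, sub_self]
      have hcop : IsCoprime f (X - 1) := by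
        refine hf.coprime_iff_not_dvd.2 fun hd => h1 ?_
        exact eq_of_monic_of_associated hm (monic_X_sub_C (1 : ZMod 2))
          (hf.associated_of_dvd (irreducible_X_sub_C (1 : ZMod 2)) hd)
      obtain ⟨u, v, huv⟩ := hcop.pow_right (n := 2)
      refine ⟨aeval (permRep n g) u (Pi.single k 1), ?_⟩
      rw [← Module.End.mul_apply, ← map_mul, mul_comm]
      have h4 := congrArg (fun q => aeval (permRep n g) q (Pi.single k 1)) huv
      simpa only [map_add, map_mul, Module.End.mul_apply, LinearMap.add_apply, h3, map_zero, add_zero,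
        map_one, Module.End.one_apply] using h4

end Cycles

end Codes

/-! ### The multiplicities in a self-dual code. -/

section SelfDual

open Polynomial HasGenerator

section CodeModule

variable {n p : ℕ} {C : Code n} {g : Equiv.Perm (Fin n)} (hg : g ∈ autGroup C)

lemma coe_aeval_codeRep (q : (ZMod 2)[X]) (c : C) :
    ((aeval (codeRep C g hg gen) q c : C) : Fin n → ZMod 2) = aeval (permRep n g) q c := by
  induction q using Polynomial.induction_on' generalizing c with
  | add p q hp hq => simp [hp, hq]
  | monomial k a =>
    rw [aeval_monomial, aeval_monomial, Module.End.mul_apply, Module.End.mul_apply,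
      Module.algebraMap_end_apply, Module.algebraMap_end_apply, Submodule.coe_smul]
    congr 1
    induction k generalizing c with
    | zero => rfl
    | succ k ih =>
      rw [pow_succ, pow_succ, Module.End.mul_apply, ih, Module.End.mul_apply]
      rfl

lemma nullity_codeRep (q : (ZMod 2)[X]) :
    nullity (ZMod 2) (codeRep C g hg).asModule q =
      Module.finrank (ZMod 2) (C ⊓ LinearMap.ker (aeval (permRep n g) q) : Code n) := by
  have hmem : ∀ c : (codeRep C g hg).asModule,
      c ∈ Submodule.torsionBy (ZMod 2)[X] (codeRep C g hg).asModule q ↔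
        ((codeRep C g hg).asModuleEquiv c : Fin n → ZMod 2) ∈
          LinearMap.ker (aeval (permRep n g) q) := by
    intro c
    rw [Submodule.mem_torsionBy_iff, LinearMap.mem_ker, ← coe_aeval_codeRep hg,
      ← asModuleEquiv_poly_smul, Submodule.coe_eq_zero, LinearEquiv.map_eq_zero_iff]
  refine LinearEquiv.finrank_eq
    { toFun := fun x => ⟨((codeRep C g hg).asModuleEquiv x.1).1,
        ((codeRep C g hg).asModuleEquiv x.1).2, (hmem x.1).1 x.2⟩
      invFun := fun v => ⟨(codeRep C g hg).asModuleEquiv.symm ⟨v.1, v.2.1⟩, (hmem _).2 v.2.2⟩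
      map_add' := fun _ _ => rfl
      map_smul' := fun _ _ => rfl
      left_inv := fun _ => rfl
      right_inv := fun _ => rfl }

lemma IsSelfDual.nullity_add_finrank_le (hC : IsSelfDual C) (hp : p.Prime)
    (hord : orderOf g = 2 * p) (hfix : ∀ k : Fin n, (g ^ p) k ≠ k) {f h : (ZMod 2)[X]}
    (hf : f ∈ irredFactors p) (hh : f.reverse * h = X ^ p - 1) :
    nullity (ZMod 2) (codeRep C g hg).asModule f + Module.finrank (ZMod 2) C ≤
      nullity (ZMod 2) (codeRep C g hg).asModule (f.reverse * (h * h)) +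
      f.natDegree * (if f.reverse = X - 1 then numCycles g (2 * p) + numCycles g 2
        else numCycles g (2 * p)) := by
  have hr := ((mem_irredFactors hp.ne_zero).1 (reverse_mem_irredFactors hp.ne_zero hf)).1
  have h1 := le_finrank_range_add_of_irreducible hp hord hfix hr
  rw [natDegree_reverse_of_mem hp.ne_zero hf] at h1
  have h2 := hC.finrank_inf_ker_add_le g f
  have h3 := hC.two_mul_finrank
  have h4 : C ⊓ LinearMap.range (aeval (permRep n g) f.reverse) ≤
      -- The image of `f*(g)` is killed by `f* h ^ 2`, since `f* h ^ 2 f* = (f* h) ^ 2 = X ^ (2p) -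
      -- 1`.
      C ⊓ LinearMap.ker (aeval (permRep n g) (f.reverse * (h * h))) := by
    refine inf_le_inf_left _ ?_
    rintro _ ⟨v, rfl⟩
    rw [LinearMap.mem_ker, ← Module.End.mul_apply, ← map_mul,
      show f.reverse * (h * h) * f.reverse = (f.reverse * h) ^ 2 by ring, hh,
      ← X_pow_two_mul_sub_one, map_sub, map_pow, aeval_X, map_one, ← map_pow, ← hord,
      pow_orderOf_eq_one, map_one, sub_self, LinearMap.zero_apply]
  have h5 := Submodule.finrank_mono h4
  rw [nullity_codeRep, nullity_codeRep]
  omega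

end CodeModule

section Multiplicities

variable {n p : ℕ} {C : Code n} {g : Equiv.Perm (Fin n)} {hg : g ∈ autGroup C} {m : ℕ}
  {V W : Fin (m + 1) → Rep.{0} (ZMod 2) (Subgroup.zpowers g)} {F : Fin (m + 1) → (ZMod 2)[X]}
  {y z : Fin (m + 1) → ℕ}

lemma orderOf_gen_zpowers (g : Equiv.Perm (Fin n)) :
    orderOf (gen : Subgroup.zpowers g) = orderOf g :=
  (Subgroup.orderOf_coe _).symm

lemma HasDecomposition.finrank_eq (h : HasDecomposition (codeRep C g hg) V W y z)
    (hFi : ∀ i, Irreducible (F i))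
    (eV : ∀ i, Nonempty ((V i).ρ.asModule ≃ₗ[(ZMod 2)[X]] (ZMod 2)[X] ⧸ Ideal.span {F i}))
    (eW : ∀ i, Nonempty ((W i).ρ.asModule ≃ₗ[(ZMod 2)[X]] (ZMod 2)[X] ⧸ Ideal.span {F i ^ 2})) :
    Module.finrank (ZMod 2) C = ∑ i, (F i).natDegree * (2 * y i + z i) := by
  have h0 := h.nullity_eq
    (fun i => finiteDimensional_of_equiv_quotient _ (hFi i).ne_zero (eV i).some)
    (fun i => finiteDimensional_of_equiv_quotient _ (pow_ne_zero 2 (hFi i).ne_zero) (eW i).some) 0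
  rw [nullity_of_smul_eq_zero (fun _ => zero_smul _ _),
    (Representation.asModuleEquiv _).finrank_eq] at h0
  rw [h0]
  refine Finset.sum_congr rfl fun i _ => ?_
  rw [nullity_of_smul_eq_zero (fun _ => zero_smul _ _),
    nullity_of_smul_eq_zero (fun _ => zero_smul _ _),
    ((eV i).some.restrictScalars (ZMod 2)).finrank_eq,
    ((eW i).some.restrictScalars (ZMod 2)).finrank_eq, finrank_quotient_span_eq_natDegree,
    finrank_quotient_span_eq_natDegree, natDegree_pow]
  ring

/-- Each copy of `V_i` and each copy of `W_i` contributes exactly `deg F_i` to the kernel of `F_i`;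
the other summands are dropped. -/
lemma HasDecomposition.natDegree_mul_le_nullity (h : HasDecomposition (codeRep C g hg) V W y z)
    (hFi : ∀ i, Irreducible (F i))
    (eV : ∀ i, Nonempty ((V i).ρ.asModule ≃ₗ[(ZMod 2)[X]] (ZMod 2)[X] ⧸ Ideal.span {F i}))
    (eW : ∀ i, Nonempty ((W i).ρ.asModule ≃ₗ[(ZMod 2)[X]] (ZMod 2)[X] ⧸ Ideal.span {F i ^ 2}))
    (i : Fin (m + 1)) :
    (F i).natDegree * (y i + z i) ≤ nullity (ZMod 2) (codeRep C g hg).asModule (F i) := by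
  rw [h.nullity_eq
    (fun i => finiteDimensional_of_equiv_quotient _ (hFi i).ne_zero (eV i).some)
    (fun i => finiteDimensional_of_equiv_quotient _ (pow_ne_zero 2 (hFi i).ne_zero) (eW i).some)]
  refine le_trans (le_of_eq ?_) (Finset.single_le_sum (fun _ _ => Nat.zero_le _)
    (Finset.mem_univ i))
  have h1 := nullity_quotient_sq (hFi i).ne_zero (isCoprime_one_right (x := F i))
  rw [mul_one] at h1
  rw [nullity_congr (eV i).some, nullity_congr (eW i).some, h1,
    nullity_of_smul_eq_zero (smul_quotient_eq_zero _), finrank_quotient_span_eq_natDegree]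
  ring

/-- On a copy of `W_i` the kernel of `F_i u` has only half the dimension, which loses `deg F_i`;
every other summand is bounded by its full dimension. -/
lemma HasDecomposition.nullity_add_le (h : HasDecomposition (codeRep C g hg) V W y z)
    (hFi : ∀ i, Irreducible (F i))
    (eV : ∀ i, Nonempty ((V i).ρ.asModule ≃ₗ[(ZMod 2)[X]] (ZMod 2)[X] ⧸ Ideal.span {F i}))
    (eW : ∀ i, Nonempty ((W i).ρ.asModule ≃ₗ[(ZMod 2)[X]] (ZMod 2)[X] ⧸ Ideal.span {F i ^ 2}))
    (i : Fin (m + 1)) {u : (ZMod 2)[X]} (hu : IsCoprime (F i) u) :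
    nullity (ZMod 2) (codeRep C g hg).asModule (F i * u) + (F i).natDegree * y i ≤
      Module.finrank (ZMod 2) C := by
  have fV := fun i => finiteDimensional_of_equiv_quotient _ (hFi i).ne_zero (eV i).some
  have fW := fun i =>
    finiteDimensional_of_equiv_quotient _ (pow_ne_zero 2 (hFi i).ne_zero) (eW i).some
  have dV : ∀ j, Module.finrank (ZMod 2) (V j).ρ.asModule = (F j).natDegree := fun j => by
    rw [((eV j).some.restrictScalars (ZMod 2)).finrank_eq, finrank_quotient_span_eq_natDegree]
  have dW : ∀ j, Module.finrank (ZMod 2) (W j).ρ.asModule = 2 * (F j).natDegree := fun j => by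
    rw [((eW j).some.restrictScalars (ZMod 2)).finrank_eq, finrank_quotient_span_eq_natDegree,
      natDegree_pow]
  rw [h.nullity_eq fV fW, h.finrank_eq hFi eV eW, ← Finset.add_sum_erase _ _ (Finset.mem_univ i),
    ← Finset.add_sum_erase _ (fun i => (F i).natDegree * (2 * y i + z i)) (Finset.mem_univ i),
    add_right_comm]
  refine add_le_add ?_ (Finset.sum_le_sum fun j _ => ?_)
  · have h1 : nullity (ZMod 2) (V i).ρ.asModule (F i * u) ≤ (F i).natDegree :=
      (nullity_le _).trans (dV i).le
    rw [nullity_congr (eW i).some, nullity_quotient_sq (hFi i).ne_zero hu]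
    nlinarith [Nat.mul_le_mul_left (z i) h1]
  · have h1 : nullity (ZMod 2) (V j).ρ.asModule (F i * u) ≤ (F j).natDegree :=
      (nullity_le _).trans (dV j).le
    have h2 : nullity (ZMod 2) (W j).ρ.asModule (F i * u) ≤ 2 * (F j).natDegree :=
      (nullity_le _).trans (dW j).le
    nlinarith [Nat.mul_le_mul_left (z j) h1, Nat.mul_le_mul_left (y j) h2]

/-- The multiplicities in a self-dual code: `i'` is the index of the dual of the `i`-th module. -/
lemma HasDecomposition.multiplicities (h : HasDecomposition (codeRep C g hg) V W y z)
    (hC : IsSelfDual C) (hp : p.Prime) (hp2 : Odd p) (hord : orderOf g = 2 * p)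
    (hfix : ∀ k : Fin n, (g ^ p) k ≠ k) (hF0 : F 0 = X - 1) (hinj : Function.Injective F)
    (hF : ∀ f, f ∈ irredFactors p ↔ ∃ i, F i = f)
    (eV : ∀ i, Nonempty ((V i).ρ.asModule ≃ₗ[(ZMod 2)[X]] (ZMod 2)[X] ⧸ Ideal.span {F i}))
    (eW : ∀ i, Nonempty ((W i).ρ.asModule ≃ₗ[(ZMod 2)[X]] (ZMod 2)[X] ⧸ Ideal.span {F i ^ 2}))
    {i i' : Fin (m + 1)} (hii : F i' = (F i).reverse) :
    y i + y i' + z i =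
      if i = 0 then numCycles g (2 * p) + numCycles g 2 else numCycles g (2 * p) := by
  have hmem : ∀ i, F i ∈ irredFactors p := fun i => (hF _).2 ⟨i, rfl⟩
  have hFi : ∀ i, Irreducible (F i) := fun i => ((mem_irredFactors hp.ne_zero).1 (hmem i)).1
  -- `s` is the permutation of indices induced by `f ↦ f*`, an involution preserving degrees and
  -- fixing `0`.
  choose s hs using fun i => (hF _).1 (reverse_mem_irredFactors hp.ne_zero (hmem i))
  have hss : Function.Involutive s := fun i => hinj (by
    rw [hs, hs, reverse_reverse_of_mem hp.ne_zero (hmem i)])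
  have hd : ∀ i, (F (s i)).natDegree = (F i).natDegree := fun i => by
    rw [hs, natDegree_reverse_of_mem hp.ne_zero (hmem i)]
  have hs0 : s 0 = 0 := hinj (by
    rw [hs, hF0]
    simpa using reverse_X_pow_sub_one 1)
  have hle : ∀ i, (F i).natDegree * (y i + y (s i) + z i) ≤ (F i).natDegree *
      (if i = 0 then numCycles g (2 * p) + numCycles g 2 else numCycles g (2 * p)) := by
    intro i
    obtain ⟨u, hu, hc⟩ := exists_cofactor hp2 (hmem (s i))
    have h1 := h.natDegree_mul_le_nullity hFi eV eW i
    have h2 := h.nullity_add_le hFi eV eW (s i) (hc.mul_right hc)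
    rw [hs] at hu
    have h3 := hC.nullity_add_finrank_le hg hp hord hfix (hmem i) hu
    have h4 : (F i).reverse = X - 1 ↔ i = 0 := by
      rw [← hs, ← hF0, hinj.eq_iff]
      exact ⟨fun h => by rw [← hss i, h, hs0], fun h => by rw [h, hs0]⟩
    rw [hd, hs] at h2
    simp only [h4] at h3
    rw [add_right_comm, mul_add]
    omega
  -- Reindexing by `s` turns the left side into `dim C = n / 2`; the right side is `p x + w` because
  -- the degrees sum to `p` and `F 0` has degree `1`.
  have hsum : ∑ i, (F i).natDegree * (y i + y (s i) + z i) = ∑ i, (F i).natDegree *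
      (if i = 0 then numCycles g (2 * p) + numCycles g 2 else numCycles g (2 * p)) := by
    have h1 : ∑ i, (F i).natDegree * y (s i) = ∑ i, (F i).natDegree * y i :=
      Fintype.sum_equiv hss.toPerm _ _ fun i => by
        change _ = (F (s i)).natDegree * y (s i)
        rw [hd]
    have h2 := h.finrank_eq hFi eV eW
    have h3 := hC.two_mul_finrank
    have h4 := eq_two_mul_numCycles hp hord hfix
    have h5 : ∑ i, (F i).natDegree = p := by
      have himg : irredFactors p = Finset.univ.image F := by
        ext f
        simp [hF]
      rw [← sum_natDegree_irredFactors hp2, himg, Finset.sum_image hinj.injOn]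
    have h6 : ∀ i, (F i).natDegree * (if i = 0 then numCycles g (2 * p) + numCycles g 2
        else numCycles g (2 * p)) = (F i).natDegree * numCycles g (2 * p) +
          if i = 0 then numCycles g 2 else 0 := by
      intro i
      split_ifs with hi
      · rw [hi, hF0, show (X - 1 : (ZMod 2)[X]).natDegree = 1 from natDegree_X_sub_C (1 : ZMod 2)]
        ring
      · ring
    rw [Finset.sum_congr rfl fun i _ => h6 i, Finset.sum_add_distrib, ← Finset.sum_mul, h5,
      Finset.sum_ite_eq' Finset.univ 0, if_pos (Finset.mem_univ _)]
    simp only [mul_add, Finset.sum_add_distrib, h1] at h2 ⊢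
    have h7 : ∑ i, (F i).natDegree * (2 * y i) = 2 * ∑ i, (F i).natDegree * y i := by
      rw [Finset.mul_sum]
      exact Finset.sum_congr rfl fun i _ => by ring
    omega
  have heq := (Finset.sum_eq_sum_iff_of_le fun i _ => hle i).1 hsum i (Finset.mem_univ i)
  have hi' : i' = s i := hinj (by rw [hii, hs])
  rw [hi']
  exact Nat.eq_of_mul_eq_mul_left (hFi i).natDegree_pos heq

end Multiplicities

end SelfDual

end BinaryCode

end

/-! ### The theorem. -/

theorem mainTheorem4 (n p : ℕ) (hp : p.Prime) (hp_odd : Odd p)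
    (C : BinaryCode.Code n) (hC : BinaryCode.IsSelfDual C)
    (g : Equiv.Perm (Fin n)) (hg : g ∈ BinaryCode.autGroup C)
    (hord : orderOf g = 2 * p) (hfix : ∀ k : Fin n, (g ^ p) k ≠ k)
    (x w : ℕ) (hx : x = BinaryCode.numCycles g (2 * p)) (hw : w = BinaryCode.numCycles g 2) :
    (∃ V W : Fin (BinaryCode.nu p + 1) → Rep.{0} (ZMod 2) (Subgroup.zpowers g),
      BinaryCode.IsNumberingOfIrreducibles (Subgroup.zpowers g) (BinaryCode.nu p) V ∧
      ∀ i, BinaryCode.IsProjectiveCover (MonoidAlgebra (ZMod 2) (Subgroup.zpowers g))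
        (W i).ρ.asModule (V i).ρ.asModule) ∧
    ∀ V W : Fin (BinaryCode.nu p + 1) → Rep.{0} (ZMod 2) (Subgroup.zpowers g),
      BinaryCode.IsNumberingOfIrreducibles (Subgroup.zpowers g) (BinaryCode.nu p) V →
      (∀ i, BinaryCode.IsProjectiveCover (MonoidAlgebra (ZMod 2) (Subgroup.zpowers g))
        (W i).ρ.asModule (V i).ρ.asModule) →
      (∃ y z : Fin (BinaryCode.nu p + 1) → ℕ,
        BinaryCode.HasDecomposition (BinaryCode.codeRep C g hg) V W y z) ∧
      ∀ y z : Fin (BinaryCode.nu p + 1) → ℕ,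
        BinaryCode.HasDecomposition (BinaryCode.codeRep C g hg) V W y z →
        2 * y 0 + z 0 = x + w ∧
        (Even (BinaryCode.ordTwo p) → ∀ i, i ≠ 0 → 2 * y i + z i = x) ∧
        (Odd (BinaryCode.ordTwo p) → ∀ i, i ≠ 0 →
          ∃ j, j ≠ 0 ∧ j ≠ i ∧
            Nonempty ((V i).ρ.dual.Equiv (V j).ρ) ∧
            z i = z j ∧ y i + y j + z i = x) := by
  open BinaryCode in
  have hgen : orderOf (HasGenerator.gen : Subgroup.zpowers g) = 2 * p := by
    rw [orderOf_gen_zpowers, hord]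
  refine ⟨exists_numbering hp hp_odd hgen, fun V W hV hW => ?_⟩
  obtain ⟨F, hF0, hinj, hF, eV⟩ := hV.exists_labelling hp hgen
  have hmem : ∀ i, F i ∈ irredFactors p := fun i => (hF _).2 ⟨i, rfl⟩
  have hFi : ∀ i, Irreducible (F i) := fun i => ((mem_irredFactors hp.ne_zero).1 (hmem i)).1
  have eW := fun i => (hW i).nonempty_equiv_quotient_sq hp_odd hgen (hmem i) (eV i)
  refine ⟨exists_hasDecomposition hp hp_odd hgen hF eV eW, fun y z h => ?_⟩
  have key := fun i i' => h.multiplicities (i := i) (i' := i') hC hp hp_odd hord hfix hF0 hinj hF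
    eV eW
  rw [← hx, ← hw] at key
  have hrev0 : (F 0).reverse = F 0 := by
    rw [hF0]
    simpa using reverse_X_pow_sub_one 1
  refine ⟨?_, fun hs i hi => ?_, fun hs i hi => ?_⟩
  · have h0 := key 0 0 hrev0.symm
    rw [if_pos rfl] at h0
    omega
  · have h0 := key i i (reverse_eq_self_of_even hp hp_odd hs (hmem i)).symm
    rw [if_neg hi] at h0
    omega
  · obtain ⟨j, hj⟩ := (hF _).1 (reverse_mem_irredFactors hp.ne_zero (hmem i))
    have hji : F i = (F j).reverse := by
      rw [hj, reverse_reverse_of_mem hp.ne_zero (hmem i)]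
    have hj0 : j ≠ 0 := by
      rintro rfl
      exact hi (hinj (by rw [hji, hrev0]))
    have hne : j ≠ i := by
      rintro rfl
      exact reverse_ne_self_of_odd hp hp_odd hs (hmem j) (fun hX => hj0 (hinj (by rw [hX, hF0])))
        hj.symm
    -- The equalities for `i` and for its dual `j` share the term `y i + y j`, whence `z i = z j`.
    have h1 := key i j hj
    have h2 := key j i hji
    rw [if_neg hi] at h1
    rw [if_neg hj0] at h2
    refine ⟨j, hj0, hne, ?_, by omega, h1⟩
    obtain ⟨E⟩ := nonempty_dual_equiv_quotient (V i).ρ (hFi i)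
      (coeff_zero_ne_of_dvd_X_pow_sub_one hp.ne_zero ((mem_irredFactors hp.ne_zero).1 (hmem i)).2) (eV i).some
    rw [← hj] at E
    exact (nonempty_repEquiv_iff _ _).2 ⟨E.trans (eV j).some.symm⟩
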